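/- Let $0<\alpha<2$, $\varepsilon>0$, $\Omega=(-\pi,\pi)$ and $H=L^2(\Omega)$ (real-valued). For $\varphi\in C_c^\infty(\Omega)$, extended by zero to $\mathbb R$, put $$(-\Delta)^{\alpha/2}\varphi(x)=C(1,\alpha)\,\mathrm{P.V.}\!\int_{\mathbb R}\frac{\varphi(x)-\varphi(y)}{|x-y|^{1+\alpha}}\,dy,\qquad C(1,\alpha)=\frac{\alpha}{2^{1-\alpha}\pi^{1/2}}\,\frac{\Gamma(\frac{1+\alpha}{2})}{\Gamma(1-\frac{\alpha}{2})}.$$ Let $A_\varepsilon=-\varepsilon\Delta+(-\Delta)^{\alpha/2}$ be the operator in $H$ with exterior condition $u=0$ on $\mathbb R\setminus\Omega$: $u\in D(A_\varepsilon)$ and $A_\varepsilon u=w$ if and only if $u\in H^1_0(\Omega)$, $w\in L^2(\Omega)$ and $\int_\Omega u\,(-\varepsilon\varphi''+(-\Delta)^{\alpha/2}\varphi)\,dx=\int_\Omega w\varphi\,dx$ for all $\varphi\in C_c^\infty(\Omega)$. Let $g\in L^2(\Omega)$ and let $f:\mathbb R\to\mathbb R$ be such that $u\mapsto f\circ u$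 maps $H$ into $H$ and is locally Lipschitz on $H$ (every point of $H$ has a neighbourhood on which the map is Lipschitz). Assume that for some $p\ge 2$ and some positive constants $c_1,c_2,c_3,c_4$ $$c_1|s|^p-c_2\le f(s)s\le c_3|s|^p+c_4\qquad\text{for all } s\in\mathbb R .$$ Consider the problem $$u_t-\varepsilon\Delta u+(-\Delta)^{\alpha/2}u+f(u)=g\ \text{ in }\Omega,\qquad u|_{\mathbb R\setminus\Omega}=0,\qquad u(0)=u_0 .\tag{1}$$ A solution of (1) on $[0,T]$ is a function $u\in C([0,T];H)$ with $u(0)=u_0$ such that for all $\varphi\in D(A_\varepsilon)$ and $t\in[0,T]$ $$\langle u(t),\varphi\rangle=\langle u_0,\varphi\rangle+\int_0^t\big(-\langle u(s),A_\varepsilon\varphi\rangle-\langle f(u(s)),\varphi\rangle+\langle g,\varphi\rangle\big)\,ds .$$ Then $-A_\varepsilon$ is the infinitesimal generator of a strongly continuous semigroup $(e^{-A_\varepsilon t})_{t\ge0}$ on $H$, and for every $u_0\in H$ there is a function $u\in C([0,\infty);H)$ which is a solution of (1) on $[0,T]$ for every $T>0$ and is given by the variation-of-constants formula $$u(t)=e^{-A_\varepsilon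 t}u_0-\int_0^te^{-A_\varepsilon(t-s)}\big(f(u(s))-g\big)\,ds,\qquad t\ge0.$$ It is unique: for every $T>0$, each $v\in C([0,T];H)$ that is a solution of (1) on $[0,T]$, or that satisfies the variation-of-constants formula on $[0,T]$, coincides with $u$ on $[0,T]$. -/

import Mathlib

open Set Filter Topology MeasureTheory
open scoped ContDiff

noncomputable section

namespace AnomalousDiffusion

/-- The interval `Ω = (-π, π)`. -/
def Ω : Set ℝ := Ioo (-Real.pi) Real.pi

/-- Lebesgue measure on `Ω`. -/
def μΩ : Measure ℝ := volume.restrict Ω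

/-- The real Hilbert space `H = L²(Ω)`. -/
abbrev H : Type := Lp ℝ 2 μΩ

/-- `φ ∈ C_c^∞(Ω)`, regarded as a function on `ℝ` (zero outside `Ω`). -/
structure IsTestFunction (φ : ℝ → ℝ) : Prop where
  smooth : ContDiff ℝ ∞ φ
  compactSupport : HasCompactSupport φ
  support_subset : tsupport φ ⊆ Ω

/-- The constant `C(1, α) = α / (2^(1-α) π^(1/2)) * Γ((1+α)/2) / Γ(1-α/2)`. -/
def fracConst (α : ℝ) : ℝ :=
  α / ((2 : ℝ) ^ (1 - α) * Real.pi ^ (1 / 2 : ℝ)) *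
    (Real.Gamma ((1 + α) / 2) / Real.Gamma (1 - α / 2))

/-- The fractional Laplacian `(-Δ)^(α/2)` on `ℝ`, applied to a function `φ` at the point `x`:
`C(1, α)` times the principal value of `∫ (φ x - φ y) / |x - y|^(1+α) dy`.
It is only used for `φ ∈ C_c^∞` and `0 < α < 2`, where the principal value exists. -/
def fracLaplacian (α : ℝ) (φ : ℝ → ℝ) (x : ℝ) : ℝ :=
  fracConst α * limUnder (𝓝[>] (0 : ℝ)) fun δ : ℝ =>
    ∫ y in {y : ℝ | δ ≤ |x - y|}, (φ x - φ y) / |x - y| ^ (1 + α)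

/-- `u ∈ H₀¹(Ω)` with weak derivative `u'`: the pair `(u, u')` is an `L²`-limit of pairs
`(φ, φ')` with `φ ∈ C_c^∞(Ω)`. -/
def IsH01WithDeriv (u u' : H) : Prop :=
  (u, u') ∈ closure {q : H × H | ∃ φ : ℝ → ℝ, IsTestFunction φ ∧
    (q.1 : ℝ → ℝ) =ᵐ[μΩ] φ ∧ (q.2 : ℝ → ℝ) =ᵐ[μΩ] deriv φ}

/-- The Sobolev space `H₀¹(Ω)` as a subset of `L²(Ω)`. -/
def H01 : Set H := {u | ∃ u' : H, IsH01WithDeriv u u'}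

/-- The graph of the operator `A_ε = -ε Δ + (-Δ)^(α/2)` of `L²(Ω)` with exterior condition
`u = 0` on `ℝ \ Ω`: `IsAeps ε α u w` says that `u` is in the domain of `A_ε` and `A_ε u = w`,
that is, `u ∈ H₀¹(Ω)`, `w ∈ L²(Ω)`, and `-ε Δ u + (-Δ)^(α/2) u = w` holds in the sense of
distributions on `Ω`, where `u` is extended by zero. -/
def IsAeps (ε α : ℝ) (u w : H) : Prop :=
  u ∈ H01 ∧ ∀ φ : ℝ → ℝ, IsTestFunction φ →
    ∫ x in Ω, u x * (-ε * iteratedDeriv 2 φ x + fracLaplacian α φ x) = ∫ x in Ω, w x * φ x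

/-- `S` (of which only the values at `t ≥ 0` matter) is a strongly continuous semigroup
of bounded operators on `H`. -/
structure IsC0Semigroup (S : ℝ → H →L[ℝ] H) : Prop where
  zero : S 0 = ContinuousLinearMap.id ℝ H
  add : ∀ s t : ℝ, 0 ≤ s → 0 ≤ t → S (s + t) = (S s).comp (S t)
  strongly_continuous : ∀ x : H, ContinuousOn (fun t => S t x) (Ici 0)

/-- `S t = e^{-A t}`: `S` is a `C₀`-semigroup whose infinitesimal generator is `-A`, where the
operator `A` is given by its graph. -/
def IsExpNeg (A : H → H → Prop) (S : ℝ → H →L[ℝ] H) : Prop :=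
  IsC0Semigroup S ∧ ∀ u w : H,
    A u w ↔ Tendsto (fun t : ℝ => t⁻¹ • (S t u - u)) (𝓝[>] 0) (𝓝 (-w))

/-- The map `u ↦ f ∘ u` of `L²(Ω)` into itself induced by a scalar function `f`. -/
def nemytskii (f : ℝ → ℝ) (hf : ∀ u : H, MemLp (fun x => f (u x)) 2 μΩ) (u : H) : H :=
  (hf u).toLp (fun x => f (u x))

/-- `c₁ |s|^p - c₂ ≤ f(s) s ≤ c₃ |s|^p + c₄` for all real `s`, with positive constants. -/
def GrowthCondition (f : ℝ → ℝ) (p : ℝ) : Prop :=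
  ∃ c₁ c₂ c₃ c₄ : ℝ, 0 < c₁ ∧ 0 < c₂ ∧ 0 < c₃ ∧ 0 < c₄ ∧
    ∀ s : ℝ, c₁ * |s| ^ p - c₂ ≤ f s * s ∧ f s * s ≤ c₃ * |s| ^ p + c₄

/-- `u ∈ C([0,T]; H)` is a (weak) solution on `[0,T]` of
`du/dt + A u + F(u) = g`, `u(0) = u₀`, for a symmetric operator `A` given by its graph:
for all `φ` in the domain of `A`, with `ψ = A φ`, the function `t ↦ ⟨u(t), φ⟩` is absolutely
continuous with derivative `-⟨u(t), ψ⟩ - ⟨F(u(t)), φ⟩ + ⟨g, φ⟩`. -/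
structure IsSolutionOn (A : H → H → Prop) (F : H → H) (g u₀ : H) (T : ℝ) (u : ℝ → H) :
    Prop where
  continuousOn : ContinuousOn u (Icc 0 T)
  initial : u 0 = u₀
  equation : ∀ φ ψ : H, A φ ψ → ∀ t ∈ Icc 0 T,
    inner ℝ (u t) φ = inner ℝ u₀ φ +
      ∫ s in (0 : ℝ)..t, (-inner ℝ (u s) ψ - inner ℝ (F (u s)) φ + inner ℝ g φ)

/-- The variation-of-constants formula at time `t`:
`u(t) = S(t) u₀ - ∫₀ᵗ S(t-s) (F(u(s)) - g) ds`. -/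
def VariationOfConstants (S : ℝ → H →L[ℝ] H) (F : H → H) (g u₀ : H) (u : ℝ → H) (t : ℝ) :
    Prop :=
  u t = S t u₀ - ∫ s in (0 : ℝ)..t, S (t - s) (F (u s) - g)

end AnomalousDiffusion

end

/-!
The form `ε ∫ φ' ψ' + C(1, α) ∬ (φ x - φ y) (ψ x - ψ y) / |x - y|^(1 + α)` is symmetric and
nonnegative on `C_c^∞(Ω)`. Together with the `L²` norm it is equivalent to the `H¹` norm, because
`α < 2`, so `A_ε` is the Friedrichs extension of `-ε Δ + (-Δ)^(α/2)`: a nonnegative self-adjoint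
operator. Its contraction semigroup is the limit of the exponentials of the Yosida approximations.
Weak and mild solutions of the linear inhomogeneous equation agree, since the primitive `V` of the
difference of two weak solutions satisfies `V' + A_ε V = 0`, so that its norm decreases from `0`.

Testing the local Lipschitz condition at `0` on multiples of indicators of short intervals shows
that `f` is globally Lipschitz. The variation-of-constants formula is therefore a Volterra equation
with Lipschitz kernel, and the Volterra map is a contraction in an exponentially weighted sup norm.
-/

namespace AnomalousDiffusion

/-! ### Uniformly bounded families of operators -/

section StrongConvergence

variable {ι 𝕜 X Y : Type*} [NontriviallyNormedField 𝕜] [NormedAddCommGroup X] [NormedSpace 𝕜 X]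
  [NormedAddCommGroup Y] [NormedSpace 𝕜 Y] {l : Filter ι} {T : ι → X →L[𝕜] Y} {C : ℝ}

theorem tendsto_apply_of_eventually_norm_le (hT : ∀ᶠ i in l, ‖T i‖ ≤ C) {x : ι → X} {x₀ : X} {y : Y}
    (hx : Tendsto x l (𝓝 x₀)) (hy : Tendsto (fun i => T i x₀) l (𝓝 y)) :
    Tendsto (fun i => T i (x i)) l (𝓝 y) := by
  have hsub : Tendsto (fun i => T i (x i - x₀)) l (𝓝 0) := by
    have hlim : Tendsto (fun i => C * ‖x i - x₀‖) l (𝓝 0) := by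
      simpa only [mul_zero] using (tendsto_iff_norm_sub_tendsto_zero.1 hx).const_mul C
    exact squeeze_zero_norm' (hT.mono fun i hi => (T i).le_of_opNorm_le hi _) hlim
  simpa only [map_sub, sub_add_cancel, zero_add] using hsub.add hy

theorem tendsto_zero_of_dense {s : Set X} (hs : Dense s) (hT : ∀ᶠ i in l, ‖T i‖ ≤ C)
    (h : ∀ x ∈ s, Tendsto (fun i => T i x) l (𝓝 0)) (x : X) :
    Tendsto (fun i => T i x) l (𝓝 0) := by
  refine NormedAddGroup.tendsto_nhds_zero.2 fun ε hε => ?_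
  obtain ⟨y, hxy, hy⟩ := Metric.dense_iff.1 hs x (ε / 2 / (|C| + 1)) (by positivity)
  rw [mem_ball_iff_norm', lt_div_iff₀ (by positivity)] at hxy
  filter_upwards [hT, NormedAddGroup.tendsto_nhds_zero.1 (h y hy) (ε / 2) (half_pos hε)]
    with i hi hiy
  have hdiff : ‖T i (x - y)‖ ≤ ‖x - y‖ * (|C| + 1) := by
    rw [mul_comm]
    exact (T i).le_of_opNorm_le (by linarith [le_abs_self C]) _
  calc ‖T i x‖ = ‖T i (x - y) + T i y‖ := by rw [map_sub, sub_add_cancel]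
    _ ≤ ‖T i (x - y)‖ + ‖T i y‖ := norm_add_le _ _
    _ < ε := by linarith

theorem continuous_uncurry_of_norm_le [TopologicalSpace ι] (hT : ∀ i, ‖T i‖ ≤ C)
    (h : ∀ x, Continuous fun i => T i x) : Continuous fun p : ι × X => T p.1 p.2 :=
  continuous_iff_continuousAt.2 fun p =>
    tendsto_apply_of_eventually_norm_le (T := fun p : ι × X => T p.1)
      (Eventually.of_forall fun p => hT p.1) continuousAt_snd
      ((h p.2).continuousAt.comp continuousAt_fst)

end StrongConvergence

/-! ### Semigroups generated by bounded operators -/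

section ExpNeg

section Banach

variable {X : Type*} [NormedAddCommGroup X] [NormedSpace ℝ X]

/-- The semigroup `e^{-tB}` generated by a bounded operator `-B`. -/
noncomputable def expNeg (B : X →L[ℝ] X) (t : ℝ) : X →L[ℝ] X := NormedSpace.exp (t • (-B))

theorem expNeg_zero (B : X →L[ℝ] X) : expNeg B 0 = 1 := by
  rw [expNeg, zero_smul, NormedSpace.exp_zero]

theorem commute_expNeg {B C : X →L[ℝ] X} (h : Commute B C) (t : ℝ) : Commute B (expNeg C t) :=
  ((h.neg_right).smul_right t).exp_right

variable [CompleteSpace X]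

theorem expNeg_add (B : X →L[ℝ] X) (s t : ℝ) : expNeg B (s + t) = expNeg B s * expNeg B t := by
  let _ := NormedAlgebra.restrictScalars ℚ ℝ (X →L[ℝ] X)
  rw [expNeg, add_smul]
  exact NormedSpace.exp_add_of_commute (((Commute.refl (-B)).smul_left s).smul_right t)

theorem hasDerivAt_expNeg (B : X →L[ℝ] X) (t : ℝ) :
    HasDerivAt (expNeg B) (expNeg B t * (-B)) t :=
  hasDerivAt_exp_smul_const (-B) t

theorem hasDerivAt_expNeg_apply (B : X →L[ℝ] X) (t : ℝ) (x : X) :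
    HasDerivAt (fun s => expNeg B s x) (-(expNeg B t (B x))) t := by
  simpa using (hasDerivAt_expNeg B t).clm_apply (hasDerivAt_const t x)

theorem continuous_expNeg_apply (B : X →L[ℝ] X) (x : X) : Continuous fun t => expNeg B t x :=
  continuous_iff_continuousAt.2 fun t => (hasDerivAt_expNeg_apply B t x).continuousAt

theorem expNeg_sub_eq_integral (B : X →L[ℝ] X) (t : ℝ) (x : X) :
    expNeg B t x - x = -∫ s in (0 : ℝ)..t, expNeg B s (B x) := by
  have h := intervalIntegral.integral_eq_sub_of_hasDerivAt (a := 0) (b := t)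
    (fun s _ => hasDerivAt_expNeg_apply B s x)
    ((continuous_expNeg_apply B (B x)).neg.intervalIntegrable _ _)
  rw [intervalIntegral.integral_neg, expNeg_zero, one_apply_eq_self] at h
  exact h.symm

end Banach

variable {X : Type*} [NormedAddCommGroup X] [InnerProductSpace ℝ X] [CompleteSpace X]
  {B C : X →L[ℝ] X}

theorem norm_expNeg_le_one (hB : ∀ x, 0 ≤ inner ℝ (B x) x) {t : ℝ} (ht : 0 ≤ t) :
    ‖expNeg B t‖ ≤ 1 := by
  refine ContinuousLinearMap.opNorm_le_bound _ zero_le_one fun x => ?_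
  have hderiv (s : ℝ) : HasDerivAt (fun s => ‖expNeg B s x‖ ^ 2)
      (2 * inner ℝ (expNeg B s x) (-(expNeg B s (B x)))) s :=
    (hasDerivAt_expNeg_apply B s x).norm_sq
  have hanti : Antitone fun s => ‖expNeg B s x‖ ^ 2 := by
    refine antitone_of_deriv_nonpos (fun s => (hderiv s).differentiableAt) fun s => ?_
    have hcomm : expNeg B s (B x) = B (expNeg B s x) :=
      (DFunLike.congr_fun (commute_expNeg (Commute.refl B) s).eq x).symm
    rw [(hderiv s).deriv, inner_neg_right, real_inner_comm, hcomm]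
    linarith [hB (expNeg B s x)]
  have hle : ‖expNeg B t x‖ ^ 2 ≤ ‖x‖ ^ 2 := by
    simpa only [expNeg_zero, one_apply_eq_self] using hanti ht
  rw [one_mul]
  exact (sq_le_sq₀ (norm_nonneg _) (norm_nonneg _)).1 hle

theorem norm_expNeg_apply_le (hB : ∀ x, 0 ≤ inner ℝ (B x) x) {t : ℝ} (ht : 0 ≤ t) (x : X) :
    ‖expNeg B t x‖ ≤ ‖x‖ := by
  simpa only [one_mul] using (expNeg B t).le_of_opNorm_le (norm_expNeg_le_one hB ht) x

theorem inner_expNeg (hB : ∀ x y, inner ℝ (B x) y = inner ℝ x (B y)) (t : ℝ) (x y : X) :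
    inner ℝ (expNeg B t x) y = inner ℝ x (expNeg B t y) := by
  have hself : IsSelfAdjoint B := ContinuousLinearMap.isSelfAdjoint_iff_isSymmetric.2 hB
  have hexp : IsSelfAdjoint (expNeg B t) := by
    rw [isSelfAdjoint_iff, expNeg, NormedSpace.star_exp, star_smul, star_neg, hself.star_eq,
      star_trivial]
  exact ContinuousLinearMap.isSelfAdjoint_iff_isSymmetric.1 hexp x y

theorem norm_expNeg_sub_expNeg_le_of_le (hB : ∀ x, 0 ≤ inner ℝ (B x) x) {s t : ℝ} (hs : 0 ≤ s)
    (hst : s ≤ t) (x : X) : ‖expNeg B t x - expNeg B s x‖ ≤ ‖B x‖ * (t - s) :=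
  norm_image_sub_le_of_norm_deriv_le_segment'
    (fun r _ => (hasDerivAt_expNeg_apply B r x).hasDerivWithinAt)
    (fun r hr => by
      rw [norm_neg]
      exact norm_expNeg_apply_le hB (hs.trans hr.1) (B x)) t ⟨hst, le_rfl⟩

theorem hasDerivAt_expNeg_expNeg_sub (hBC : Commute B C) (t r : ℝ) (x : X) :
    HasDerivAt (fun r => expNeg B r (expNeg C (t - r) x))
      (expNeg B r (expNeg C (t - r) (C x - B x))) r := by
  have hC : HasDerivAt (fun r => expNeg C (t - r) x) (expNeg C (t - r) (C x)) r := by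
    simpa [Function.comp_def] using
      (hasDerivAt_expNeg_apply C (t - r) x).scomp r ((hasDerivAt_id r).const_sub t)
  have hcomm : B (expNeg C (t - r) x) = expNeg C (t - r) (B x) :=
    DFunLike.congr_fun (commute_expNeg hBC (t - r)).eq x
  refine ((hasDerivAt_expNeg B r).clm_apply hC).congr_deriv ?_
  simp only [map_sub, ← hcomm, mul_apply_eq_comp, neg_apply, map_neg]
  abel

theorem norm_expNeg_sub_expNeg_le_of_commute (hB : ∀ x, 0 ≤ inner ℝ (B x) x)
    (hC : ∀ x, 0 ≤ inner ℝ (C x) x) (hBC : Commute B C) {t : ℝ} (ht : 0 ≤ t) (x : X) :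
    ‖expNeg B t x - expNeg C t x‖ ≤ ‖B x - C x‖ * t := by
  have h := norm_image_sub_le_of_norm_deriv_le_segment' (C := ‖B x - C x‖)
    (fun r _ => (hasDerivAt_expNeg_expNeg_sub hBC t r x).hasDerivWithinAt)
    (fun r hr => by
      rw [norm_sub_rev (B x)]
      exact (norm_expNeg_apply_le hB hr.1 _).trans
        (norm_expNeg_apply_le hC (sub_nonneg.2 hr.2.le) _)) t ⟨ht, le_rfl⟩
  simpa only [expNeg_zero, sub_self, sub_zero, one_apply_eq_self] using h

end ExpNeg

/-! ### The Hille–Yosida theorem -/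

/-- The relation `A` is the graph of a linear m-accretive operator on a real Hilbert space. Graphs
of operators are used because this is how unbounded operators are encoded in `IsExpNeg`. -/
structure IsMAccretive {X : Type*} [NormedAddCommGroup X] [InnerProductSpace ℝ X]
    (A : X → X → Prop) : Prop where
  add : ∀ {u w v z}, A u w → A v z → A (u + v) (w + z)
  smul : ∀ (c : ℝ) {u w}, A u w → A (c • u) (c • w)
  nonneg : ∀ {u w}, A u w → 0 ≤ inner ℝ w u
  single_valued : ∀ {w}, A 0 w → w = 0
  surjective : ∀ {l : ℝ}, 0 < l → ∀ x, ∃ u w, A u w ∧ l • u + w = x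

/-- The relation `A` is the graph of a nonnegative self-adjoint operator; self-adjointness is
expressed as symmetry together with surjectivity of `l + A` for `l > 0`. -/
structure IsNonnegSelfAdjoint {X : Type*} [NormedAddCommGroup X] [InnerProductSpace ℝ X]
    (A : X → X → Prop) : Prop extends IsMAccretive A where
  symm : ∀ {u w v z}, A u w → A v z → inner ℝ w v = inner ℝ u z

section Resolvent

variable {X : Type*} [NormedAddCommGroup X] [InnerProductSpace ℝ X]

/-- The resolvent `(l + A)⁻¹` of the operator with graph `A`; an arbitrary operator unless
`l + A` is bijective with bounded inverse. -/
noncomputable def resolvent (A : X → X → Prop) (l : ℝ) : X →L[ℝ] X :=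
  Classical.epsilon fun R : X →L[ℝ] X => ∀ x, A (R x) (x - l • R x)

/-- The Yosida approximation `l A (l + A)⁻¹ = l (1 - l (l + A)⁻¹)`. -/
noncomputable def yosida (A : X → X → Prop) (l : ℝ) : X →L[ℝ] X := l • (1 - l • resolvent A l)

theorem yosida_apply (A : X → X → Prop) (l : ℝ) (x : X) :
    yosida A l x = l • (x - l • resolvent A l x) := rfl

namespace IsMAccretive

variable {A : X → X → Prop}

theorem sub (hA : IsMAccretive A) {u w v z : X} (h : A u w) (h' : A v z) : A (u - v) (w - z) := by
  simpa [sub_eq_add_neg] using hA.add h (hA.smul (-1) h')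

theorem mul_norm_le (hA : IsMAccretive A) {u w : X} (l : ℝ) (h : A u w) :
    l * ‖u‖ ≤ ‖l • u + w‖ := by
  have hsq : l * ‖u‖ ^ 2 ≤ inner ℝ (l • u + w) u := by
    rw [inner_add_left, real_inner_smul_left, real_inner_self_eq_norm_sq]
    linarith [hA.nonneg h]
  have hinner := real_inner_le_norm (l • u + w) u
  rcases (norm_nonneg u).eq_or_lt with hu | hu
  · rw [← hu, mul_zero]
    exact norm_nonneg _
  · exact le_of_mul_le_mul_right (by linarith) hu

theorem eq_of_smul_add_eq (hA : IsMAccretive A) {u w v z : X} {l : ℝ} (hl : 0 < l)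
    (h : A u w) (h' : A v z) (he : l • u + w = l • v + z) : u = v := by
  have hle := hA.mul_norm_le l (hA.sub h h')
  rw [show l • (u - v) + (w - z) = (l • u + w) - (l • v + z) by module, he, sub_self,
    norm_zero] at hle
  exact sub_eq_zero.1 (norm_le_zero_iff.1 (nonpos_of_mul_nonpos_right hle hl))

theorem exists_resolvent (hA : IsMAccretive A) {l : ℝ} (hl : 0 < l) :
    ∃ R : X →L[ℝ] X, ∀ x, A (R x) (x - l • R x) := by
  choose R W hR hx using hA.surjective hl
  let R' : X →ₗ[ℝ] X :=
    { toFun := R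
      map_add' := fun x y => by
        refine hA.eq_of_smul_add_eq hl (hR (x + y)) (hA.add (hR x) (hR y)) ?_
        rw [hx, smul_add, add_add_add_comm, hx, hx]
      map_smul' := fun c x => by
        refine hA.eq_of_smul_add_eq hl (hR (c • x)) (hA.smul c (hR x)) ?_
        rw [hx, RingHom.id_apply, smul_comm, ← smul_add, hx] }
  refine ⟨R'.mkContinuous l⁻¹ fun x => ?_, fun x => ?_⟩
  · rw [inv_mul_eq_div, le_div_iff₀' hl]
    exact (hA.mul_norm_le l (hR x)).trans_eq (congrArg _ (hx x))
  · have hW : W x = x - l • R x := eq_sub_of_add_eq' (hx x)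
    exact hW ▸ hR x

theorem resolvent_spec (hA : IsMAccretive A) {l : ℝ} (hl : 0 < l) (x : X) :
    A (resolvent A l x) (x - l • resolvent A l x) :=
  Classical.epsilon_spec (hA.exists_resolvent hl) x

theorem resolvent_smul_add (hA : IsMAccretive A) {l : ℝ} (hl : 0 < l) {u w : X} (h : A u w) :
    resolvent A l (l • u + w) = u :=
  hA.eq_of_smul_add_eq hl (hA.resolvent_spec hl _) h (add_sub_cancel _ _)

theorem norm_resolvent_le (hA : IsMAccretive A) {l : ℝ} (hl : 0 < l) : ‖resolvent A l‖ ≤ l⁻¹ := by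
  refine ContinuousLinearMap.opNorm_le_bound _ (inv_nonneg.2 hl.le) fun x => ?_
  have h := hA.mul_norm_le l (hA.resolvent_spec hl x)
  rwa [add_sub_cancel, ← le_div_iff₀' hl, div_eq_inv_mul] at h

theorem norm_smul_resolvent_le (hA : IsMAccretive A) {l : ℝ} (hl : 0 < l) :
    ‖l • resolvent A l‖ ≤ 1 := by
  rw [norm_smul, Real.norm_of_nonneg hl.le, ← le_div_iff₀' hl, one_div]
  exact hA.norm_resolvent_le hl

theorem smul_resolvent_sub (hA : IsMAccretive A) {l : ℝ} (hl : 0 < l) {u w : X} (h : A u w) :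
    u - l • resolvent A l u = resolvent A l w := by
  rw [sub_eq_iff_eq_add', ← map_smul, ← map_add, hA.resolvent_smul_add hl h]

theorem resolvent_sub_resolvent (hA : IsMAccretive A) {l m : ℝ} (hl : 0 < l) (hm : 0 < m) (x : X) :
    resolvent A l x - resolvent A m x = (m - l) • resolvent A l (resolvent A m x) := by
  have h := hA.smul_resolvent_sub hl (hA.resolvent_spec hm x)
  rw [map_sub, map_smul] at h
  linear_combination (norm := module) (-1 : ℝ) • h

theorem commute_resolvent (hA : IsMAccretive A) {l m : ℝ} (hl : 0 < l) (hm : 0 < m) :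
    Commute (resolvent A l) (resolvent A m) := by
  rcases eq_or_ne m l with rfl | hne
  · exact Commute.refl _
  · ext x
    have h := hA.resolvent_sub_resolvent hm hl x
    rw [← neg_sub, hA.resolvent_sub_resolvent hl hm x, ← neg_smul, neg_sub] at h
    exact smul_right_injective X (sub_ne_zero.2 hne.symm) h

theorem commute_yosida (hA : IsMAccretive A) {l m : ℝ} (hl : 0 < l) (hm : 0 < m) :
    Commute (yosida A l) (yosida A m) := by
  have h := hA.commute_resolvent hl hm
  exact (((Commute.one_left _).sub_left
    (((Commute.one_right _).sub_right (h.smul_right m)).smul_left l)).smul_left l).smul_right m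

theorem yosida_apply_eq (hA : IsMAccretive A) {l : ℝ} (hl : 0 < l) {u w : X} (h : A u w) :
    yosida A l u = l • resolvent A l w := by
  rw [yosida_apply, hA.smul_resolvent_sub hl h]

theorem norm_yosida_apply_le (hA : IsMAccretive A) {l : ℝ} (hl : 0 < l) {u w : X} (h : A u w) :
    ‖yosida A l u‖ ≤ ‖w‖ := by
  rw [hA.yosida_apply_eq hl h, ← one_mul ‖w‖]
  exact (l • resolvent A l).le_of_opNorm_le (hA.norm_smul_resolvent_le hl) w

theorem yosida_nonneg (hA : IsMAccretive A) {l : ℝ} (hl : 0 < l) (x : X) :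
    0 ≤ inner ℝ (yosida A l x) x := by
  set w := x - l • resolvent A l x with hw
  have hx : inner ℝ w x = ‖w‖ ^ 2 + l * inner ℝ w (resolvent A l x) := by
    rw [← real_inner_self_eq_norm_sq, ← real_inner_smul_right, ← inner_add_right, hw,
      sub_add_cancel]
  have hnonneg := hA.nonneg (hA.resolvent_spec hl x)
  rw [yosida_apply, real_inner_smul_left, hx]
  positivity

theorem dense_domain [CompleteSpace X] (hA : IsMAccretive A) : Dense {u : X | ∃ w, A u w} := by
  let D : Submodule ℝ X :=
    { carrier := {u | ∃ w, A u w}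
      add_mem' := fun ⟨w, h⟩ ⟨z, h'⟩ => ⟨w + z, hA.add h h'⟩
      zero_mem' := ⟨_, zero_smul ℝ (resolvent A 1 0) ▸ hA.smul 0 (hA.resolvent_spec one_pos 0)⟩
      smul_mem' := fun c _ ⟨w, h⟩ => ⟨c • w, hA.smul c h⟩ }
  suffices h : Dᗮ = ⊥ from Submodule.dense_iff_topologicalClosure_eq_top.2
    (Submodule.topologicalClosure_eq_top_iff.2 h)
  refine (Submodule.eq_bot_iff _).2 fun x hx => ?_
  obtain ⟨u, w, h, rfl⟩ := hA.surjective one_pos x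
  have horth : inner ℝ u ((1 : ℝ) • u + w) = 0 := (Submodule.mem_orthogonal _ _).1 hx u ⟨w, h⟩
  rw [one_smul, inner_add_right, real_inner_self_eq_norm_sq, real_inner_comm] at horth
  have hu : u = 0 := by
    have hsq : ‖u‖ ^ 2 = 0 := le_antisymm (by linarith [hA.nonneg h]) (sq_nonneg _)
    simpa using hsq
  subst hu
  rw [hA.single_valued h, smul_zero, add_zero]

theorem tendsto_smul_resolvent [CompleteSpace X] (hA : IsMAccretive A) (x : X) :
    Tendsto (fun l => l • resolvent A l x) atTop (𝓝 x) := by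
  have hbound : ∀ᶠ l in atTop, ‖l • resolvent A l - 1‖ ≤ 1 + 1 := by
    filter_upwards [eventually_gt_atTop 0] with l hl
    exact (norm_sub_le _ _).trans
      (add_le_add (hA.norm_smul_resolvent_le hl) ContinuousLinearMap.norm_id_le)
  refine tendsto_sub_nhds_zero_iff.1
    (tendsto_zero_of_dense hA.dense_domain hbound (fun u ⟨w, h⟩ => ?_) x)
  have hlim : Tendsto (fun l : ℝ => l⁻¹ * ‖w‖) atTop (𝓝 0) := by
    simpa only [zero_mul] using tendsto_inv_atTop_zero.mul_const ‖w‖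
  refine squeeze_zero_norm' ?_ hlim
  filter_upwards [eventually_gt_atTop 0] with l hl
  change ‖l • resolvent A l u - u‖ ≤ _
  rw [norm_sub_rev, hA.smul_resolvent_sub hl h]
  exact (resolvent A l).le_of_opNorm_le (hA.norm_resolvent_le hl) w

theorem tendsto_yosida_apply [CompleteSpace X] (hA : IsMAccretive A) {u w : X} (h : A u w) :
    Tendsto (fun l => yosida A l u) atTop (𝓝 w) := by
  refine (hA.tendsto_smul_resolvent w).congr' ?_
  filter_upwards [eventually_gt_atTop 0] with l hl
  exact (hA.yosida_apply_eq hl h).symm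

end IsMAccretive

theorem IsNonnegSelfAdjoint.inner_yosida {A : X → X → Prop} (hA : IsNonnegSelfAdjoint A) {l : ℝ}
    (hl : 0 < l) (x y : X) : inner ℝ (yosida A l x) y = inner ℝ x (yosida A l y) := by
  have h := hA.symm (hA.resolvent_spec hl x) (hA.resolvent_spec hl y)
  simp only [inner_sub_left, inner_sub_right, real_inner_smul_left, real_inner_smul_right] at h
  simp only [yosida_apply, real_inner_smul_left, real_inner_smul_right, inner_sub_left,
    inner_sub_right]
  linear_combination l ^ 2 * h

end Resolvent

section Semigroup

variable {X : Type*} [NormedAddCommGroup X] [InnerProductSpace ℝ X] {A : X → X → Prop}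

/-- The contraction semigroup `e^{-tA}`, as the strong limit of the semigroups generated by the
Yosida approximations of `A`. It is extended to `t < 0` by the identity, so that it is strongly
continuous on all of `ℝ`; it is arbitrary if the strong limit does not exist. -/
noncomputable def semigroup (A : X → X → Prop) (t : ℝ) : X →L[ℝ] X :=
  Classical.epsilon fun S : X →L[ℝ] X =>
    ∀ x, Tendsto (fun l => expNeg (yosida A l) (max t 0) x) atTop (𝓝 (S x))

variable [CompleteSpace X]

namespace IsMAccretive

theorem eventually_norm_expNeg_yosida_le (hA : IsMAccretive A) {t : ℝ} (ht : 0 ≤ t) :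
    ∀ᶠ l in atTop, ‖expNeg (yosida A l) t‖ ≤ 1 := by
  filter_upwards [eventually_gt_atTop 0] with l hl using norm_expNeg_le_one (hA.yosida_nonneg hl) ht

theorem cauchySeq_expNeg_yosida (hA : IsMAccretive A) {t : ℝ} (ht : 0 ≤ t) (x : X) :
    CauchySeq fun l => expNeg (yosida A l) t x := by
  have hpos : ∀ᶠ p : ℝ × ℝ in atTop, 0 < p.1 ∧ 0 < p.2 := by
    filter_upwards [eventually_ge_atTop (1, 1)] with p hp
    exact ⟨one_pos.trans_le hp.1, one_pos.trans_le hp.2⟩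
  have hbound : ∀ᶠ p : ℝ × ℝ in atTop,
      ‖expNeg (yosida A p.1) t - expNeg (yosida A p.2) t‖ ≤ 1 + 1 := by
    filter_upwards [hpos] with p hp
    exact (norm_sub_le _ _).trans (add_le_add (norm_expNeg_le_one (hA.yosida_nonneg hp.1) ht)
      (norm_expNeg_le_one (hA.yosida_nonneg hp.2) ht))
  refine cauchySeq_iff_tendsto_dist_atTop_0.2 ?_
  simp only [dist_eq_norm]
  refine tendsto_zero_iff_norm_tendsto_zero.1
    (tendsto_zero_of_dense hA.dense_domain hbound (fun u ⟨w, h⟩ => ?_) x)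
  have hlim := (cauchySeq_iff_tendsto_dist_atTop_0.1
    (hA.tendsto_yosida_apply h).cauchySeq).mul_const t
  simp only [dist_eq_norm, zero_mul] at hlim
  refine squeeze_zero_norm' ?_ hlim
  filter_upwards [hpos] with p hp
  exact norm_expNeg_sub_expNeg_le_of_commute (hA.yosida_nonneg hp.1) (hA.yosida_nonneg hp.2)
    (hA.commute_yosida hp.1 hp.2) ht u

theorem tendsto_expNeg_yosida_max (hA : IsMAccretive A) (t : ℝ) (x : X) :
    Tendsto (fun l => expNeg (yosida A l) (max t 0) x) atTop (𝓝 (semigroup A t x)) := by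
  choose S hS using fun x =>
    cauchySeq_tendsto_of_complete (hA.cauchySeq_expNeg_yosida (le_max_right t 0) x)
  exact Classical.epsilon_spec
    (p := fun S : X →L[ℝ] X =>
      ∀ x, Tendsto (fun l => expNeg (yosida A l) (max t 0) x) atTop (𝓝 (S x)))
    ⟨continuousLinearMapOfTendsto _ (tendsto_pi_nhds.2 hS), hS⟩ x

theorem tendsto_expNeg_yosida (hA : IsMAccretive A) {t : ℝ} (ht : 0 ≤ t) (x : X) :
    Tendsto (fun l => expNeg (yosida A l) t x) atTop (𝓝 (semigroup A t x)) := by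
  simpa only [max_eq_left ht] using hA.tendsto_expNeg_yosida_max t x

theorem norm_semigroup_le_one (hA : IsMAccretive A) (t : ℝ) : ‖semigroup A t‖ ≤ 1 := by
  refine ContinuousLinearMap.opNorm_le_bound _ zero_le_one fun x =>
    le_of_tendsto (hA.tendsto_expNeg_yosida_max t x).norm ?_
  filter_upwards [hA.eventually_norm_expNeg_yosida_le (le_max_right t 0)] with l hl
    using ContinuousLinearMap.le_of_opNorm_le _ hl x

theorem norm_semigroup_apply_le (hA : IsMAccretive A) (t : ℝ) (x : X) :
    ‖semigroup A t x‖ ≤ ‖x‖ := by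
  simpa only [one_mul] using (semigroup A t).le_of_opNorm_le (hA.norm_semigroup_le_one t) x

theorem semigroup_zero (hA : IsMAccretive A) : semigroup A 0 = ContinuousLinearMap.id ℝ X := by
  ext x
  refine tendsto_nhds_unique (hA.tendsto_expNeg_yosida le_rfl x) ?_
  simp only [expNeg_zero, one_apply_eq_self, ContinuousLinearMap.id_apply, tendsto_const_nhds]

theorem semigroup_add (hA : IsMAccretive A) {s t : ℝ} (hs : 0 ≤ s) (ht : 0 ≤ t) :
    semigroup A (s + t) = (semigroup A s).comp (semigroup A t) := by
  ext x
  refine tendsto_nhds_unique (hA.tendsto_expNeg_yosida (add_nonneg hs ht) x) ?_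
  simp only [expNeg_add, mul_apply_eq_comp]
  exact tendsto_apply_of_eventually_norm_le (hA.eventually_norm_expNeg_yosida_le hs)
    (hA.tendsto_expNeg_yosida ht x) (hA.tendsto_expNeg_yosida hs _)

theorem norm_semigroup_sub_le (hA : IsMAccretive A) {u w : X} (h : A u w) (s t : ℝ) :
    ‖semigroup A t u - semigroup A s u‖ ≤ ‖w‖ * |t - s| := by
  wlog hst : s ≤ t generalizing s t
  · rw [norm_sub_rev, abs_sub_comm]
    exact this t s (le_of_not_ge hst)
  refine le_of_tendsto
    ((hA.tendsto_expNeg_yosida_max t u).sub (hA.tendsto_expNeg_yosida_max s u)).norm ?_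
  filter_upwards [eventually_gt_atTop 0] with l hl
  have hmax : max s 0 ≤ max t 0 := max_le_max_right 0 hst
  calc ‖expNeg (yosida A l) (max t 0) u - expNeg (yosida A l) (max s 0) u‖
      ≤ ‖yosida A l u‖ * (max t 0 - max s 0) :=
        norm_expNeg_sub_expNeg_le_of_le (hA.yosida_nonneg hl) (le_max_right s 0) hmax u
    _ ≤ ‖w‖ * |t - s| :=
        mul_le_mul (hA.norm_yosida_apply_le hl h)
          ((le_abs_self _).trans (abs_max_sub_max_le_abs t s 0)) (sub_nonneg.2 hmax) (norm_nonneg w)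

theorem continuous_semigroup_apply (hA : IsMAccretive A) (x : X) :
    Continuous fun t => semigroup A t x := by
  refine continuous_iff_continuousAt.2 fun s => tendsto_sub_nhds_zero_iff.1 ?_
  have hbound : ∀ᶠ t in 𝓝 s, ‖semigroup A t - semigroup A s‖ ≤ 1 + 1 :=
    Eventually.of_forall fun t => (norm_sub_le _ _).trans
      (add_le_add (hA.norm_semigroup_le_one t) (hA.norm_semigroup_le_one s))
  refine tendsto_zero_of_dense hA.dense_domain hbound (fun u ⟨w, h⟩ => ?_) x
  have hlim : Tendsto (fun t => ‖w‖ * |t - s|) (𝓝 s) (𝓝 0) :=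
    Continuous.tendsto' (by fun_prop) _ _ (by simp)
  exact squeeze_zero_norm (fun t => hA.norm_semigroup_sub_le h s t) hlim

theorem semigroup_sub_eq_integral (hA : IsMAccretive A) {u w : X} (h : A u w) {t : ℝ}
    (ht : 0 ≤ t) : semigroup A t u - u = -∫ s in (0 : ℝ)..t, semigroup A s w := by
  refine tendsto_nhds_unique ((hA.tendsto_expNeg_yosida ht u).sub_const u) ?_
  simp only [expNeg_sub_eq_integral]
  refine (intervalIntegral.tendsto_integral_filter_of_dominated_convergence (fun _ => ‖w‖)
    (Eventually.of_forall fun l => (continuous_expNeg_apply _ _).aestronglyMeasurable) ?_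
    intervalIntegrable_const (ae_of_all _ fun s hs => ?_)).neg
  · filter_upwards [eventually_gt_atTop 0] with l hl
    refine ae_of_all _ fun s hs => ?_
    rw [uIoc_of_le ht] at hs
    exact (norm_expNeg_apply_le (hA.yosida_nonneg hl) hs.1.le _).trans
      (hA.norm_yosida_apply_le hl h)
  · rw [uIoc_of_le ht] at hs
    exact tendsto_apply_of_eventually_norm_le (hA.eventually_norm_expNeg_yosida_le hs.1.le)
      (hA.tendsto_yosida_apply h) (hA.tendsto_expNeg_yosida hs.1.le w)

theorem tendsto_slope_semigroup (hA : IsMAccretive A) {u w : X} (h : A u w) :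
    Tendsto (fun t : ℝ => t⁻¹ • (semigroup A t u - u)) (𝓝[>] 0) (𝓝 (-w)) := by
  have hc := hA.continuous_semigroup_apply w
  have hderiv : HasDerivAt (fun t => ∫ s in (0 : ℝ)..t, semigroup A s w) (semigroup A 0 w) 0 :=
    intervalIntegral.integral_hasDerivAt_right (hc.intervalIntegrable _ _)
      (hc.stronglyMeasurableAtFilter _ _) hc.continuousAt
  have hslope := hderiv.neg.tendsto_slope_zero_right
  simp only [hA.semigroup_zero, zero_add, Pi.neg_apply, intervalIntegral.integral_same, neg_zero,
    sub_zero, ContinuousLinearMap.id_apply] at hslope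
  refine hslope.congr' ?_
  filter_upwards [self_mem_nhdsWithin] with t ht
  rw [hA.semigroup_sub_eq_integral h (le_of_lt ht)]

theorem inner_le_zero_of_tendsto_slope_semigroup (hA : IsMAccretive A) {u y : X}
    (h : Tendsto (fun t : ℝ => t⁻¹ • (semigroup A t u - u)) (𝓝[>] 0) (𝓝 y)) :
    inner ℝ y u ≤ 0 := by
  refine le_of_tendsto (h.inner (𝕜 := ℝ) (tendsto_const_nhds (x := u))) ?_
  filter_upwards [self_mem_nhdsWithin] with t ht
  rw [real_inner_smul_left, inner_sub_left, real_inner_self_eq_norm_mul_norm]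
  refine mul_nonpos_of_nonneg_of_nonpos (inv_nonneg.2 (le_of_lt ht)) (sub_nonpos.2 ?_)
  exact (real_inner_le_norm _ _).trans
    (mul_le_mul_of_nonneg_right (hA.norm_semigroup_apply_le t u) (norm_nonneg u))

-- The generator is dissipative and extends `-A`, while `1 + A` is already surjective.
theorem iff_tendsto_slope_semigroup (hA : IsMAccretive A) (u w : X) :
    A u w ↔ Tendsto (fun t : ℝ => t⁻¹ • (semigroup A t u - u)) (𝓝[>] 0) (𝓝 (-w)) := by
  refine ⟨hA.tendsto_slope_semigroup, fun h => ?_⟩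
  obtain ⟨v, z, hv, hsum⟩ := hA.surjective one_pos (u + w)
  rw [one_smul] at hsum
  have hdiff : -w - -z = u - v := by
    rw [← sub_eq_zero, ← sub_eq_zero.2 hsum]
    abel
  have hslope : Tendsto (fun t : ℝ => t⁻¹ • (semigroup A t (u - v) - (u - v))) (𝓝[>] 0)
      (𝓝 (u - v)) := by
    rw [← hdiff]
    refine (h.sub (hA.tendsto_slope_semigroup hv)).congr fun t => ?_
    rw [hdiff, ← smul_sub, map_sub, sub_sub_sub_comm]
  have huv : u = v := sub_eq_zero.1
    (real_inner_self_nonpos.1 (hA.inner_le_zero_of_tendsto_slope_semigroup hslope))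
  subst huv
  rwa [← add_left_cancel hsum]

end IsMAccretive

theorem IsNonnegSelfAdjoint.inner_semigroup (hA : IsNonnegSelfAdjoint A) (t : ℝ) (x y : X) :
    inner ℝ (semigroup A t x) y = inner ℝ x (semigroup A t y) := by
  refine tendsto_nhds_unique ((hA.tendsto_expNeg_yosida_max t x).inner tendsto_const_nhds)
    ((tendsto_const_nhds.inner (hA.tendsto_expNeg_yosida_max t y)).congr' ?_)
  filter_upwards [eventually_gt_atTop 0] with l hl
  exact (inner_expNeg (hA.inner_yosida hl) _ x y).symm

end Semigroup

/-! ### Volterra integral equations -/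

section Volterra

variable {E : Type*} [NormedAddCommGroup E] [NormedSpace ℝ E] {k : ℝ → ℝ → E → E} {a : ℝ → E}
  {L : NNReal} {T : ℝ}

/-- `u` solves the Volterra equation `u(t) = a(t) + ∫₀ᵗ k(t, s, u(s)) ds` on `[0, T]`. -/
structure IsVolterraSolutionOn (k : ℝ → ℝ → E → E) (a : ℝ → E) (T : ℝ) (u : ℝ → E) : Prop where
  continuousOn : ContinuousOn u (Icc 0 T)
  eq : ∀ t ∈ Icc 0 T, u t = a t + ∫ s in (0 : ℝ)..t, k t s (u s)

theorem IsVolterraSolutionOn.mono {u : ℝ → E} (h : IsVolterraSolutionOn k a T u) {T' : ℝ}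
    (hT : T' ≤ T) : IsVolterraSolutionOn k a T' u :=
  ⟨h.continuousOn.mono (Icc_subset_Icc_right hT), fun t ht => h.eq t (Icc_subset_Icc_right hT ht)⟩

theorem IsVolterraSolutionOn.congr {u v : ℝ → E} (h : IsVolterraSolutionOn k a T u)
    (huv : EqOn v u (Icc 0 T)) : IsVolterraSolutionOn k a T v := by
  refine ⟨h.continuousOn.congr huv, fun t ht => ?_⟩
  rw [huv ht, h.eq t ht]
  congr 1
  refine intervalIntegral.integral_congr fun s hs => ?_
  rw [uIcc_of_le ht.1] at hs
  rw [huv ⟨hs.1, hs.2.trans ht.2⟩]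

theorem integral_exp_mul {K : ℝ} (hK : K ≠ 0) (t : ℝ) :
    ∫ s in (0 : ℝ)..t, Real.exp (K * s) = (Real.exp (K * t) - 1) / K := by
  rw [intervalIntegral.integral_comp_mul_left Real.exp hK, integral_exp, mul_zero, Real.exp_zero,
    smul_eq_mul, inv_mul_eq_div]

theorem continuous_volterra (hk : Continuous fun p : ℝ × ℝ × E => k p.1 p.2.1 p.2.2)
    (ha : Continuous a) {u : ℝ → E} (hu : Continuous u) :
    Continuous fun t => a t + ∫ s in (0 : ℝ)..t, k t s (u s) := by
  refine ha.add (intervalIntegral.continuous_parametric_intervalIntegral_of_continuous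
    (f := fun t s => k t s (u s)) ?_ continuous_id)
  exact hk.comp (continuous_fst.prodMk (continuous_snd.prodMk (hu.comp continuous_snd)))

/-- The map whose fixed points are the functions `t ↦ e^{-Kt} u(t)` with `u` a solution of the
Volterra equation on `[0, T]`. The exponential weight (Bielecki's trick) makes it a contraction
for large `K`, without a smallness condition on `T`. -/
noncomputable def weightedVolterraMap (hk : Continuous fun p : ℝ × ℝ × E => k p.1 p.2.1 p.2.2)
    (ha : Continuous a) (hT : 0 ≤ T) (K : ℝ) (w : C(Icc (0 : ℝ) T, E)) : C(Icc (0 : ℝ) T, E) where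
  toFun t := Real.exp (-(K * t)) •
    (a t + ∫ s in (0 : ℝ)..t, k t s (Real.exp (K * s) • IccExtend hT w s))
  continuous_toFun := by
    have hw : Continuous fun s => Real.exp (K * s) • IccExtend hT w s := by fun_prop
    exact Continuous.smul (by fun_prop) ((continuous_volterra hk ha hw).comp continuous_subtype_val)

theorem IsVolterraSolutionOn.isFixedPt_weightedVolterraMap {u : ℝ → E}
    (h : IsVolterraSolutionOn k a T u)
    (hk : Continuous fun p : ℝ × ℝ × E => k p.1 p.2.1 p.2.2) (ha : Continuous a) (hT : 0 ≤ T)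
    (K : ℝ) :
    Function.IsFixedPt (weightedVolterraMap hk ha hT K)
      ⟨fun t => Real.exp (-(K * t)) • u t,
        (by fun_prop : Continuous fun t : Icc (0 : ℝ) T => Real.exp (-(K * t))).smul
          (continuousOn_iff_continuous_domRestrict.1 h.continuousOn)⟩ := by
  ext ⟨t, ht⟩
  change Real.exp (-(K * t)) • (a t + _) = Real.exp (-(K * t)) • u t
  rw [h.eq t ht]
  congr 2
  refine intervalIntegral.integral_congr fun s hs => ?_
  rw [uIcc_of_le ht.1] at hs
  simp only [IccExtend_of_mem hT _ ⟨hs.1, hs.2.trans ht.2⟩, ContinuousMap.coe_mk, smul_smul,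
    ← Real.exp_add, add_neg_cancel, Real.exp_zero, one_smul]

theorem isVolterraSolutionOn_of_isFixedPt
    (hk : Continuous fun p : ℝ × ℝ × E => k p.1 p.2.1 p.2.2) (ha : Continuous a) (hT : 0 ≤ T)
    {K : ℝ} {w : C(Icc (0 : ℝ) T, E)}
    (hw : Function.IsFixedPt (weightedVolterraMap hk ha hT K) w) :
    IsVolterraSolutionOn k a T fun t => Real.exp (K * t) • IccExtend hT w t := by
  refine ⟨Continuous.continuousOn (by fun_prop), fun t ht => ?_⟩
  have hfix : Real.exp (-(K * t)) •
      (a t + ∫ s in (0 : ℝ)..t, k t s (Real.exp (K * s) • IccExtend hT w s)) = w ⟨t, ht⟩ :=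
    DFunLike.congr_fun hw ⟨t, ht⟩
  rw [IccExtend_of_mem hT _ ht, ← hfix, smul_smul, ← Real.exp_add, add_neg_cancel, Real.exp_zero,
    one_smul]

theorem norm_integral_volterra_sub_le (hk : Continuous fun p : ℝ × ℝ × E => k p.1 p.2.1 p.2.2)
    (hL : ∀ t s, LipschitzWith L (k t s)) {K : ℝ} (hK : 0 < K) {u v : ℝ → E} (hu : Continuous u)
    (hv : Continuous v) {M : ℝ} (hM : ∀ s, ‖u s - v s‖ ≤ Real.exp (K * s) * M) {t : ℝ}
    (ht : 0 ≤ t) :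
    ‖(∫ s in (0 : ℝ)..t, k t s (u s)) - ∫ s in (0 : ℝ)..t, k t s (v s)‖ ≤
      Real.exp (K * t) * (L / K * M) := by
  have hM₀ : 0 ≤ M := by simpa using (norm_nonneg _).trans (hM 0)
  have hcont {u : ℝ → E} (hu : Continuous u) :
      IntervalIntegrable (fun s => k t s (u s)) volume 0 t :=
    (hk.comp (continuous_const.prodMk (continuous_id.prodMk hu))).intervalIntegrable _ _
  rw [← intervalIntegral.integral_sub (hcont hu) (hcont hv)]
  calc ‖∫ s in (0 : ℝ)..t, (k t s (u s) - k t s (v s))‖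
      ≤ ∫ s in (0 : ℝ)..t, L * M * Real.exp (K * s) := by
        refine intervalIntegral.norm_integral_le_of_norm_le ht (ae_of_all _ fun s _ => ?_)
          (Continuous.intervalIntegrable (by fun_prop) _ _)
        rw [mul_assoc, mul_comm M]
        exact ((hL t s).norm_sub_le _ _).trans (mul_le_mul_of_nonneg_left (hM s) L.coe_nonneg)
    _ = L / K * M * (Real.exp (K * t) - 1) := by
        rw [intervalIntegral.integral_const_mul, integral_exp_mul hK.ne']
        ring
    _ ≤ Real.exp (K * t) * (L / K * M) := by
        rw [mul_comm (Real.exp _)]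
        exact mul_le_mul_of_nonneg_left (sub_le_self _ zero_le_one) (by positivity)

theorem contractingWith_weightedVolterraMap
    (hk : Continuous fun p : ℝ × ℝ × E => k p.1 p.2.1 p.2.2)
    (hL : ∀ t s, LipschitzWith L (k t s)) (ha : Continuous a) (hT : 0 ≤ T) :
    ContractingWith (L / (L + 1)) (weightedVolterraMap hk ha hT (L + 1)) := by
  refine ⟨(div_lt_one (by positivity)).2 (lt_add_one L),
    LipschitzWith.of_dist_le_mul fun w w' => ?_⟩
  refine (ContinuousMap.dist_le (by positivity)).2 fun t => ?_
  have hbound (s : ℝ) : ‖Real.exp ((L + 1) * s) • IccExtend hT w s -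
      Real.exp ((L + 1) * s) • IccExtend hT w' s‖ ≤ Real.exp ((L + 1) * s) * dist w w' := by
    rw [← smul_sub, norm_smul, Real.norm_of_nonneg (Real.exp_pos _).le, ← dist_eq_norm]
    exact mul_le_mul_of_nonneg_left (ContinuousMap.dist_apply_le_dist _) (Real.exp_pos _).le
  have hle := norm_integral_volterra_sub_le hk hL (by positivity) (by fun_prop) (by fun_prop)
    hbound t.2.1
  rw [dist_eq_norm]
  change ‖Real.exp (-((L + 1) * t)) • (a t + _) - Real.exp (-((L + 1) * t)) • (a t + _)‖ ≤ _
  rw [← smul_sub, add_sub_add_left_eq_sub, norm_smul, Real.norm_of_nonneg (Real.exp_pos _).le,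
    Real.exp_neg, inv_mul_le_iff₀ (Real.exp_pos _)]
  exact hle

theorem IsVolterraSolutionOn.eqOn (hk : Continuous fun p : ℝ × ℝ × E => k p.1 p.2.1 p.2.2)
    (hL : ∀ t s, LipschitzWith L (k t s)) (ha : Continuous a) {u v : ℝ → E}
    (hu : IsVolterraSolutionOn k a T u) (hv : IsVolterraSolutionOn k a T v) :
    EqOn u v (Icc 0 T) := by
  intro t ht
  have hT : 0 ≤ T := ht.1.trans ht.2
  have heq := (contractingWith_weightedVolterraMap hk hL ha hT).fixedPoint_unique'
    (hu.isFixedPt_weightedVolterraMap hk ha hT _) (hv.isFixedPt_weightedVolterraMap hk ha hT _)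
  exact smul_right_injective E (Real.exp_pos _).ne' (DFunLike.congr_fun heq ⟨t, ht⟩)

theorem exists_isVolterraSolutionOn [CompleteSpace E]
    (hk : Continuous fun p : ℝ × ℝ × E => k p.1 p.2.1 p.2.2)
    (hL : ∀ t s, LipschitzWith L (k t s)) (ha : Continuous a) (hT : 0 ≤ T) :
    ∃ u, IsVolterraSolutionOn k a T u :=
  ⟨_, isVolterraSolutionOn_of_isFixedPt hk ha hT
    (contractingWith_weightedVolterraMap hk hL ha hT).fixedPoint_isFixedPt⟩

theorem exists_forall_isVolterraSolutionOn [CompleteSpace E]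
    (hk : Continuous fun p : ℝ × ℝ × E => k p.1 p.2.1 p.2.2)
    (hL : ∀ t s, LipschitzWith L (k t s)) (ha : Continuous a) :
    ∃ u, ∀ T, IsVolterraSolutionOn k a T u := by
  choose U hU using fun n : ℕ => exists_isVolterraSolutionOn hk hL ha n.cast_nonneg
  refine ⟨fun t => U ⌈t⌉₊ t, fun T => ?_⟩
  refine ((hU ⌈T⌉₊).mono (Nat.le_ceil T)).congr fun t ht => ?_
  exact (hU ⌈t⌉₊).eqOn hk hL ha
    ((hU ⌈T⌉₊).mono (Nat.cast_le.2 (Nat.ceil_mono ht.2))) ⟨ht.1, Nat.le_ceil t⟩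

end Volterra

/-! ### The inhomogeneous linear equation -/

section Duhamel

theorem exists_continuous_eqOn_Icc {X : Type*} [TopologicalSpace X] {f : ℝ → X} {a b : ℝ}
    (hab : a ≤ b) (hf : ContinuousOn f (Icc a b)) :
    ∃ f', Continuous f' ∧ EqOn f f' (Icc a b) :=
  ⟨IccExtend hab ((Icc a b).domRestrict f),
    (continuousOn_iff_continuous_domRestrict.1 hf).Icc_extend',
    fun _ hx => (IccExtend_of_mem hab ((Icc a b).domRestrict f) hx).symm⟩

variable {X : Type*} [NormedAddCommGroup X] [InnerProductSpace ℝ X] {A : X → X → Prop} {h : ℝ → X}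

/-- The mild solution `e^{-tA} x + ∫₀ᵗ e^{-(t-s)A} h(s) ds` of `u' + A u = h`, `u(0) = x`. -/
noncomputable def mildSolution (A : X → X → Prop) (x : X) (h : ℝ → X) (t : ℝ) : X :=
  semigroup A t x + ∫ s in (0 : ℝ)..t, semigroup A (t - s) (h s)

/-- `v` is a weak solution of `v' + A v = h`, `v(0) = x` on `[0, T]`: the equation is tested against
the elements of the domain of the symmetric operator `A`. -/
def IsWeakSolutionOn (A : X → X → Prop) (x : X) (h : ℝ → X) (T : ℝ) (v : ℝ → X) : Prop :=
  ∀ φ ψ, A φ ψ → ∀ t ∈ Icc 0 T,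
    inner ℝ (v t) φ = inner ℝ x φ + ∫ s in (0 : ℝ)..t, (-inner ℝ (v s) ψ + inner ℝ (h s) φ)

theorem IsWeakSolutionOn.congr {x : X} {h₁ h₂ v₁ v₂ : ℝ → X} {T : ℝ}
    (hw : IsWeakSolutionOn A x h₁ T v₁) (hv : EqOn v₁ v₂ (Icc 0 T)) (hh : EqOn h₁ h₂ (Icc 0 T)) :
    IsWeakSolutionOn A x h₂ T v₂ := by
  intro φ ψ hφ t ht
  rw [← hv ht, hw φ ψ hφ t ht]
  congr 1
  refine intervalIntegral.integral_congr fun s hs => ?_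
  rw [uIcc_of_le ht.1] at hs
  have hsT : s ∈ Icc 0 T := ⟨hs.1, hs.2.trans ht.2⟩
  simp only [hv hsT, hh hsT]

theorem eqOn_mildSolution {x : X} {h₁ h₂ : ℝ → X} {T : ℝ} (hh : EqOn h₁ h₂ (Icc 0 T)) :
    EqOn (mildSolution A x h₁) (mildSolution A x h₂) (Icc 0 T) := by
  intro t ht
  rw [mildSolution, mildSolution]
  congr 1
  refine intervalIntegral.integral_congr fun s hs => ?_
  rw [uIcc_of_le ht.1] at hs
  simp only [hh ⟨hs.1, hs.2.trans ht.2⟩]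

theorem IsWeakSolutionOn.sub {x₁ x₂ : X} {h₁ h₂ v₁ v₂ : ℝ → X} {T : ℝ}
    (hw₁ : IsWeakSolutionOn A x₁ h₁ T v₁) (hw₂ : IsWeakSolutionOn A x₂ h₂ T v₂)
    (hv₁ : Continuous v₁) (hv₂ : Continuous v₂) (hh₁ : Continuous h₁) (hh₂ : Continuous h₂) :
    IsWeakSolutionOn A (x₁ - x₂) (h₁ - h₂) T (v₁ - v₂) := by
  intro φ ψ hφ t ht
  have hint : ∀ v h : ℝ → X, Continuous v → Continuous h →
      IntervalIntegrable (fun s => -inner ℝ (v s) ψ + inner ℝ (h s) φ) volume 0 t :=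
    fun v h hv hh => Continuous.intervalIntegrable (by fun_prop) _ _
  rw [Pi.sub_apply, inner_sub_left, inner_sub_left, hw₁ φ ψ hφ t ht, hw₂ φ ψ hφ t ht,
    add_sub_add_comm, ← intervalIntegral.integral_sub (hint _ _ hv₁ hh₁) (hint _ _ hv₂ hh₂)]
  simp only [Pi.sub_apply, inner_sub_left]
  congr 2
  ext s
  ring

theorem IsNonnegSelfAdjoint.of_forall_inner_eq (hA : IsNonnegSelfAdjoint A) {u w : X}
    (h : ∀ φ ψ, A φ ψ → inner ℝ w φ = inner ℝ u ψ) : A u w := by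
  obtain ⟨v, z, hv, hvz⟩ := hA.surjective one_pos (u + w)
  obtain ⟨φ, ψ, hφ, hφψ⟩ := hA.surjective one_pos (u - v)
  rw [one_smul] at hvz hφψ
  have hz : z - w = u - v := by rw [sub_eq_sub_iff_add_eq_add, add_comm z, hvz]
  have horth : inner ℝ (u - v) (φ + ψ) = 0 := by
    nth_rw 1 [inner_add_right, ← hz]
    rw [inner_sub_left, inner_sub_left, h φ ψ hφ, hA.symm hv hφ]
    ring
  rw [hφψ, inner_self_eq_zero, sub_eq_zero] at horth
  rw [horth, sub_self, sub_eq_zero] at hz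
  rwa [horth, ← hz]

variable [CompleteSpace X]

section Mild

variable (hA : IsMAccretive A) (hh : Continuous h) (x : X)
include hA hh

theorem IsMAccretive.continuous_semigroup_sub_apply :
    Continuous fun p : ℝ × ℝ => semigroup A (p.1 - p.2) (h p.2) :=
  (continuous_uncurry_of_norm_le hA.norm_semigroup_le_one hA.continuous_semigroup_apply).comp
    (f := fun p : ℝ × ℝ => (p.1 - p.2, h p.2)) (by fun_prop)

theorem IsMAccretive.continuous_mildSolution : Continuous (mildSolution A x h) :=
  (hA.continuous_semigroup_apply x).add
    (intervalIntegral.continuous_parametric_intervalIntegral_of_continuous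
      (f := fun t s => semigroup A (t - s) (h s)) (hA.continuous_semigroup_sub_apply hh)
      continuous_id)

theorem IsMAccretive.mildSolution_add {t r : ℝ} (ht : 0 ≤ t) (hr : 0 ≤ r) :
    mildSolution A x h (t + r) = semigroup A r (mildSolution A x h t) +
      ∫ s in t..t + r, semigroup A (t + r - s) (h s) := by
  have hint : ∀ q a b, IntervalIntegrable (fun s => semigroup A (q - s) (h s)) volume a b :=
    fun q a b => ((hA.continuous_semigroup_sub_apply hh).comp
      (Continuous.prodMk_right q)).intervalIntegrable a b
  have hpast : ∫ s in (0 : ℝ)..t, semigroup A (t + r - s) (h s) =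
      semigroup A r (∫ s in (0 : ℝ)..t, semigroup A (t - s) (h s)) := by
    rw [← (semigroup A r).intervalIntegral_comp_comm (hint t 0 t)]
    refine intervalIntegral.integral_congr fun s hs => ?_
    rw [uIcc_of_le ht] at hs
    rw [add_sub_right_comm, add_comm, hA.semigroup_add hr (sub_nonneg.2 hs.2)]
    rfl
  rw [mildSolution, ← intervalIntegral.integral_add_adjacent_intervals (hint _ 0 t) (hint _ t _),
    hpast, add_comm t r, hA.semigroup_add hr ht, ← add_assoc, mildSolution, map_add]
  rfl

theorem IsMAccretive.tendsto_inv_smul_integral_semigroup (t : ℝ) :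
    Tendsto (fun r : ℝ => r⁻¹ • ∫ s in t..t + r, semigroup A (t + r - s) (h s))
      (𝓝[>] 0) (𝓝 (h t)) := by
  have hc : Continuous fun r : ℝ => ∫ q in (0 : ℝ)..1, semigroup A (t + r - (t + r * q))
      (h (t + r * q)) :=
    intervalIntegral.continuous_parametric_intervalIntegral_of_continuous
      (f := fun r q => semigroup A (t + r - (t + r * q)) (h (t + r * q)))
      ((hA.continuous_semigroup_sub_apply hh).comp
        (f := fun p : ℝ × ℝ => (t + p.1, t + p.1 * p.2)) (by fun_prop)) continuous_const
  have hlim := (hc.tendsto 0).mono_left (nhdsWithin_le_nhds (s := Ioi 0))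
  simp only [zero_mul, add_zero, sub_self, hA.semigroup_zero, ContinuousLinearMap.id_apply,
    intervalIntegral.integral_const, sub_zero, one_smul] at hlim
  refine hlim.congr' ?_
  filter_upwards [self_mem_nhdsWithin] with r hr
  rw [intervalIntegral.integral_comp_add_mul (fun s => semigroup A (t + r - s) (h s)) (ne_of_gt hr),
    mul_zero, mul_one, add_zero]

end Mild

theorem IsNonnegSelfAdjoint.hasDerivWithinAt_inner_mildSolution (hA : IsNonnegSelfAdjoint A)
    (hh : Continuous h) (x : X) {φ ψ : X} (hφ : A φ ψ) {t : ℝ} (ht : 0 ≤ t) :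
    HasDerivWithinAt (fun t => inner ℝ (mildSolution A x h t) φ)
      (-inner ℝ (mildSolution A x h t) ψ + inner ℝ (h t) φ) (Ioi t) t := by
  set m := mildSolution A x h
  have hslope : Tendsto (fun r : ℝ => inner ℝ (m t) (r⁻¹ • (semigroup A r φ - φ)) +
      inner ℝ (r⁻¹ • ∫ s in t..t + r, semigroup A (t + r - s) (h s)) φ) (𝓝[>] 0)
      (𝓝 (-inner ℝ (m t) ψ + inner ℝ (h t) φ)) := by
    rw [← inner_neg_right]
    exact (tendsto_const_nhds.inner (hA.tendsto_slope_semigroup hφ)).add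
      ((hA.tendsto_inv_smul_integral_semigroup hh t).inner tendsto_const_nhds)
  have hsub : Tendsto (fun s => s - t) (𝓝[>] t) (𝓝[>] 0) :=
    tendsto_nhdsWithin_iff.2 ⟨tendsto_sub_nhds_zero_iff.2 (tendsto_id.mono_left nhdsWithin_le_nhds),
      eventually_nhdsWithin_of_forall fun _ hs => sub_pos.2 (mem_Ioi.1 hs)⟩
  rw [hasDerivWithinAt_iff_tendsto_slope' self_notMem_Ioi]
  refine (hslope.comp hsub).congr' ?_
  filter_upwards [self_mem_nhdsWithin] with s hs
  have hm := hA.mildSolution_add hh x ht (sub_nonneg.2 (le_of_lt hs))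
  rw [add_sub_cancel] at hm
  simp only [Function.comp_apply, slope_def_module, m, hm, add_sub_cancel, real_inner_smul_left,
    real_inner_smul_right, inner_add_left, inner_sub_right, hA.inner_semigroup, smul_eq_mul]
  ring

theorem IsNonnegSelfAdjoint.isWeakSolutionOn_mildSolution (hA : IsNonnegSelfAdjoint A)
    (hh : Continuous h) (x : X) (T : ℝ) : IsWeakSolutionOn A x h T (mildSolution A x h) := by
  intro φ ψ hφ t ht
  have hm := hA.continuous_mildSolution hh x
  rw [intervalIntegral.integral_eq_sub_of_hasDeriv_right_of_le ht.1 (by fun_prop)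
      (fun s hs => hA.hasDerivWithinAt_inner_mildSolution hh x hφ hs.1.le)
      (Continuous.intervalIntegrable (by fun_prop) _ _)]
  simp only [mildSolution, hA.semigroup_zero, ContinuousLinearMap.id_apply,
    intervalIntegral.integral_same, add_zero, add_sub_cancel]

theorem IsNonnegSelfAdjoint.eqOn_zero_of_isWeakSolutionOn (hA : IsNonnegSelfAdjoint A) {T : ℝ}
    {v : ℝ → X} (hv : Continuous v) (hw : IsWeakSolutionOn A 0 0 T v) : EqOn v 0 (Icc 0 T) := by
  set V : ℝ → X := fun t => ∫ s in (0 : ℝ)..t, v s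
  have hderiv : ∀ t, HasDerivAt V (v t) t := fun t => (hv.integral_hasStrictDerivAt 0 t).hasDerivAt
  have hmem : ∀ t ∈ Icc 0 T, A (V t) (-v t) := fun t ht =>
    hA.of_forall_inner_eq fun φ ψ hφ => by
      have hV : inner ℝ (V t) ψ = ∫ s in (0 : ℝ)..t, inner ℝ (v s) ψ := by
        rw [real_inner_comm, ← innerSL_apply_apply ℝ,
          ← ContinuousLinearMap.intervalIntegral_comp_comm _ (hv.intervalIntegrable _ _)]
        simp only [innerSL_apply_apply, real_inner_comm]
      rw [inner_neg_left, hw φ ψ hφ t ht, hV]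
      simp
  have hanti : AntitoneOn (fun t => ‖V t‖ ^ 2) (Icc 0 T) := by
    refine antitoneOn_of_deriv_nonpos (convex_Icc 0 T)
      (fun t _ => (hderiv t).norm_sq.continuousAt.continuousWithinAt)
      (fun t _ => (hderiv t).norm_sq.differentiableAt.differentiableWithinAt) fun t ht => ?_
    have hnonneg := hA.nonneg (hmem t (interior_subset ht))
    rw [inner_neg_left, real_inner_comm] at hnonneg
    rw [(hderiv t).norm_sq.deriv]
    linarith
  intro t ht
  have hle : ‖V t‖ ^ 2 ≤ ‖V 0‖ ^ 2 := hanti (left_mem_Icc.2 (ht.1.trans ht.2)) ht ht.1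
  have hV : V t = 0 := by
    simpa [V, sq_nonpos_iff] using hle
  exact neg_eq_zero.1 (hA.single_valued (hV ▸ hmem t ht))

theorem IsNonnegSelfAdjoint.isWeakSolutionOn_iff_of_continuous (hA : IsNonnegSelfAdjoint A) {x : X}
    {T : ℝ} {v : ℝ → X} (hv : Continuous v) (hh : Continuous h) :
    IsWeakSolutionOn A x h T v ↔ EqOn v (mildSolution A x h) (Icc 0 T) := by
  have hmild := hA.isWeakSolutionOn_mildSolution hh x T
  have hm := hA.continuous_mildSolution hh x
  refine ⟨fun hw t ht => ?_, fun heq => hmild.congr heq.symm (eqOn_refl _ _)⟩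
  have hdiff := hw.sub hmild hv hm hh hh
  rw [sub_self, sub_self] at hdiff
  exact sub_eq_zero.1 (hA.eqOn_zero_of_isWeakSolutionOn (hv.sub hm) hdiff ht)

theorem IsNonnegSelfAdjoint.isWeakSolutionOn_iff (hA : IsNonnegSelfAdjoint A) {x : X} {T : ℝ}
    (hT : 0 ≤ T) {v : ℝ → X} (hv : ContinuousOn v (Icc 0 T)) (hh : ContinuousOn h (Icc 0 T)) :
    IsWeakSolutionOn A x h T v ↔ EqOn v (mildSolution A x h) (Icc 0 T) := by
  obtain ⟨v', hv', hvv'⟩ := exists_continuous_eqOn_Icc hT hv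
  obtain ⟨h', hh', hhh'⟩ := exists_continuous_eqOn_Icc hT hh
  have hmild : EqOn (mildSolution A x h) (mildSolution A x h') (Icc 0 T) := eqOn_mildSolution hhh'
  calc IsWeakSolutionOn A x h T v ↔ IsWeakSolutionOn A x h' T v' :=
        ⟨fun hw => hw.congr hvv' hhh', fun hw => hw.congr hvv'.symm hhh'.symm⟩
    _ ↔ EqOn v' (mildSolution A x h') (Icc 0 T) := hA.isWeakSolutionOn_iff_of_continuous hv' hh'
    _ ↔ EqOn v (mildSolution A x h) (Icc 0 T) :=
        ⟨fun heq => (hvv'.trans heq).trans hmild.symm, fun heq => (hvv'.symm.trans heq).trans hmild⟩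

end Duhamel

/-! ### The Friedrichs extension -/

section FormOperator

variable {X V : Type*} [NormedAddCommGroup X] [InnerProductSpace ℝ X] [NormedAddCommGroup V]
  [InnerProductSpace ℝ V] {a : V →L[ℝ] V →L[ℝ] ℝ} {J : V →L[ℝ] X}

/-- The graph of the operator in `X` associated with the form `a`, whose domain `V` is mapped to
`X` by `J`. -/
def formOperator (a : V →L[ℝ] V →L[ℝ] ℝ) (J : V →L[ℝ] X) (u w : X) : Prop :=
  ∃ v, J v = u ∧ ∀ z, a v z = inner ℝ w (J z)

theorem exists_formOperator_of_isCoercive [CompleteSpace V] {l : ℝ}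
    (h : IsCoercive (a + l • ((innerSL ℝ).bilinearComp J J : V →L[ℝ] V →L[ℝ] ℝ))) (x : X) :
    ∃ u w, formOperator a J u w ∧ l • u + w = x := by
  obtain ⟨v, hv⟩ := h.continuousLinearEquivOfBilin.surjective
    ((InnerProductSpace.toDual ℝ V).symm (innerSL ℝ x ∘L J))
  refine ⟨J v, x - l • J v, ⟨v, rfl, fun z => ?_⟩, add_sub_cancel _ _⟩
  have hz : a v z + l * inner ℝ (J v) (J z) = inner ℝ x (J z) := by
    have hvz := h.continuousLinearEquivOfBilin_apply v z
    rw [hv, InnerProductSpace.toDual_symm_apply] at hvz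
    exact hvz.symm
  rw [inner_sub_left, real_inner_smul_left, ← hz, add_sub_cancel_right]

theorem isNonnegSelfAdjoint_formOperator [CompleteSpace V]
    (hJ : ∀ w, (∀ z, inner ℝ w (J z) = 0) → w = 0) (hsymm : ∀ v z, a v z = a z v)
    (hnonneg : ∀ v, 0 ≤ a v v) {c : ℝ} (hc : 0 < c)
    (hcoercive : ∀ v, c * ‖v‖ ^ 2 ≤ a v v + ‖J v‖ ^ 2) :
    IsNonnegSelfAdjoint (formOperator a J) where
  add := by
    rintro _ w _ w' ⟨v, rfl, h⟩ ⟨v', rfl, h'⟩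
    exact ⟨v + v', map_add J v v', fun z => by
      rw [map_add, add_apply, h, h', inner_add_left]⟩
  smul := by
    rintro r _ w ⟨v, rfl, h⟩
    exact ⟨r • v, map_smul J r v, fun z => by
      rw [map_smul, smul_apply, h, real_inner_smul_left, smul_eq_mul]⟩
  symm := by
    rintro _ w _ w' ⟨v, rfl, h⟩ ⟨v', rfl, h'⟩
    rw [← h, hsymm, h', real_inner_comm]
  nonneg := by
    rintro _ w ⟨v, rfl, h⟩
    exact h v ▸ hnonneg v
  single_valued := by
    rintro w ⟨v, hv, h⟩
    have hle := hcoercive v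
    rw [h, hv, inner_zero_right, norm_zero, zero_pow two_ne_zero, add_zero] at hle
    have hv0 : v = 0 := by simpa using nonpos_of_mul_nonpos_right hle hc
    refine hJ w fun z => ?_
    rw [← h, hv0, map_zero, zero_apply]
  surjective := by
    intro l hl
    refine exists_formOperator_of_isCoercive ⟨min 1 l * c, mul_pos (lt_min one_pos hl) hc, ?_⟩
    intro v
    change min 1 l * c * ‖v‖ * ‖v‖ ≤ a v v + l * inner ℝ (J v) (J v)
    rw [real_inner_self_eq_norm_sq]
    calc min 1 l * c * ‖v‖ * ‖v‖ = min 1 l * (c * ‖v‖ ^ 2) := by ring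
      _ ≤ min 1 l * (a v v + ‖J v‖ ^ 2) :=
        mul_le_mul_of_nonneg_left (hcoercive v) (le_min zero_le_one hl.le)
      _ = min 1 l * a v v + min 1 l * ‖J v‖ ^ 2 := mul_add _ _ _
      _ ≤ 1 * a v v + l * ‖J v‖ ^ 2 :=
        add_le_add (mul_le_mul_of_nonneg_right (min_le_left _ _) (hnonneg v))
          (mul_le_mul_of_nonneg_right (min_le_right _ _) (sq_nonneg _))
      _ = a v v + l * ‖J v‖ ^ 2 := by rw [one_mul]

end FormOperator

section Friedrichs

variable {X V 𝓓 : Type*} [NormedAddCommGroup X] [InnerProductSpace ℝ X] [NormedAddCommGroup V]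
  [InnerProductSpace ℝ V] [AddCommGroup 𝓓] [Module ℝ 𝓓]

/-- The operator `T` on a space `𝓓` of test functions is symmetric and nonnegative in `X`, and the
norm of `V`, in which `𝓓` is dense, is equivalent to its form norm. Test functions are mapped to `V`
by `e` and further to `X` by `J`. -/
structure IsFormCore (e : 𝓓 →ₗ[ℝ] V) (J : V →L[ℝ] X) (T : 𝓓 →ₗ[ℝ] X) : Prop where
  denseRange : DenseRange e
  eq_zero : ∀ w, (∀ φ, inner ℝ w (J (e φ)) = 0) → w = 0
  symm : ∀ φ ψ, inner ℝ (T φ) (J (e ψ)) = inner ℝ (J (e φ)) (T ψ)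
  nonneg : ∀ φ, 0 ≤ inner ℝ (T φ) (J (e φ))
  le_norm_sq : ∃ C, ∀ φ, inner ℝ (T φ) (J (e φ)) ≤ C * ‖e φ‖ ^ 2
  norm_sq_le : ∃ c > 0, ∀ φ, c * ‖e φ‖ ^ 2 ≤ inner ℝ (T φ) (J (e φ)) + ‖J (e φ)‖ ^ 2

/-- The graph of the Friedrichs extension of `T`: the operator given weakly by `T` on the image of
the form domain `V` in `X`. -/
def friedrichs (e : 𝓓 →ₗ[ℝ] V) (J : V →L[ℝ] X) (T : 𝓓 →ₗ[ℝ] X) (u w : X) : Prop :=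
  (∃ v, J v = u) ∧ ∀ φ, inner ℝ u (T φ) = inner ℝ w (J (e φ))

/-- The functionals `v ↦ ⟨T φ, J v⟩`. -/
noncomputable def testForm (J : V →L[ℝ] X) (T : 𝓓 →ₗ[ℝ] X) : 𝓓 →ₗ[ℝ] V →L[ℝ] ℝ :=
  ((innerSL ℝ).bilinearComp (ContinuousLinearMap.id ℝ X) J).toLinearMap ∘ₗ T

/-- The extension to `V` of the form `⟨T φ, J (e ψ)⟩`. -/
noncomputable def closedForm (e : 𝓓 →ₗ[ℝ] V) (J : V →L[ℝ] X) (T : 𝓓 →ₗ[ℝ] X) :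
    V →L[ℝ] V →L[ℝ] ℝ :=
  (testForm J T).extendOfNorm e

namespace IsFormCore

variable {e : 𝓓 →ₗ[ℝ] V} {J : V →L[ℝ] X} {T : 𝓓 →ₗ[ℝ] X}

theorem exists_norm_testForm_le (h : IsFormCore e J T) :
    ∃ C, ∀ φ, ‖testForm J T φ‖ ≤ C * ‖e φ‖ := by
  obtain ⟨C, hC⟩ := h.le_norm_sq
  let B : LinearMap.BilinForm ℝ 𝓓 := (innerₗ X).compl₁₂ T (J.toLinearMap ∘ₗ e)
  have hle : ∀ φ, B φ φ ≤ |C| * ‖e φ‖ ^ 2 := fun φ =>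
    (hC φ).trans (mul_le_mul_of_nonneg_right (le_abs_self C) (sq_nonneg _))
  have hsymm : ∀ φ ψ, B φ ψ = B ψ φ := fun φ ψ =>
    (h.symm φ ψ).trans (real_inner_comm _ _)
  have hbound : ∀ φ ψ, |B φ ψ| ≤ |C| * ‖e φ‖ * ‖e ψ‖ := fun φ ψ => by
    refine abs_le_of_sq_le_sq ?_ (by positivity)
    calc B φ ψ ^ 2 = B φ ψ * B ψ φ := by rw [sq, hsymm ψ φ]
      _ ≤ B φ φ * B ψ ψ := LinearMap.BilinForm.apply_mul_apply_le_of_forall_zero_le B h.nonneg φ ψ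
      _ ≤ (|C| * ‖e φ‖ ^ 2) * (|C| * ‖e ψ‖ ^ 2) :=
        mul_le_mul (hle φ) (hle ψ) (h.nonneg ψ) (by positivity)
      _ = (|C| * ‖e φ‖ * ‖e ψ‖) ^ 2 := by ring
  refine ⟨|C|, fun φ => ContinuousLinearMap.opNorm_le_bound _ (by positivity) fun v => ?_⟩
  exact h.denseRange.induction_on v (isClosed_le (by fun_prop) (by fun_prop)) (hbound φ)

theorem closedForm_apply_left (h : IsFormCore e J T) (φ : 𝓓) (v : V) :
    closedForm e J T (e φ) v = inner ℝ (T φ) (J v) := by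
  rw [closedForm, LinearMap.extendOfNorm_eq h.denseRange h.exists_norm_testForm_le]
  rfl

theorem closedForm_apply_right (h : IsFormCore e J T) (φ : 𝓓) (v : V) :
    closedForm e J T v (e φ) = inner ℝ (J v) (T φ) := by
  refine h.denseRange.induction_on v (isClosed_eq (by fun_prop) (by fun_prop)) fun ψ => ?_
  rw [h.closedForm_apply_left, h.symm]

theorem closedForm_symm (h : IsFormCore e J T) (v z : V) :
    closedForm e J T v z = closedForm e J T z v := by
  refine h.denseRange.induction_on z (isClosed_eq (by fun_prop) (by fun_prop)) fun φ => ?_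
  rw [h.closedForm_apply_right, h.closedForm_apply_left, real_inner_comm]

theorem closedForm_nonneg (h : IsFormCore e J T) (v : V) : 0 ≤ closedForm e J T v v := by
  refine h.denseRange.induction_on v (isClosed_le (by fun_prop) (by fun_prop)) fun φ => ?_
  rw [h.closedForm_apply_left]
  exact h.nonneg φ

theorem formOperator_closedForm_iff (h : IsFormCore e J T) (u w : X) :
    formOperator (closedForm e J T) J u w ↔ friedrichs e J T u w := by
  constructor
  · rintro ⟨v, rfl, hv⟩
    exact ⟨⟨v, rfl⟩, fun φ => by rw [← h.closedForm_apply_right, hv]⟩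
  · rintro ⟨⟨v, rfl⟩, hv⟩
    refine ⟨v, rfl, fun z => ?_⟩
    refine h.denseRange.induction_on z (isClosed_eq (by fun_prop) (by fun_prop)) fun φ => ?_
    rw [h.closedForm_apply_right, hv]

theorem isNonnegSelfAdjoint_friedrichs [CompleteSpace V] (h : IsFormCore e J T) :
    IsNonnegSelfAdjoint (friedrichs e J T) := by
  obtain ⟨c, hc, hle⟩ := h.norm_sq_le
  have heq : formOperator (closedForm e J T) J = friedrichs e J T :=
    funext₂ fun u w => propext (h.formOperator_closedForm_iff u w)
  rw [← heq]
  refine isNonnegSelfAdjoint_formOperator (fun w hw => h.eq_zero w fun φ => hw (e φ))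
    h.closedForm_symm h.closedForm_nonneg hc fun v => ?_
  refine h.denseRange.induction_on v (isClosed_le (by fun_prop) (by fun_prop)) fun φ => ?_
  rw [h.closedForm_apply_left]
  exact hle φ

end IsFormCore

end Friedrichs

/-! ### The fractional Laplacian of a compactly supported function -/

section FractionalLaplacian

variable {φ ψ : ℝ → ℝ} {α : ℝ}

theorem fracConst_nonneg (hα₀ : 0 < α) (hα₂ : α < 2) : 0 ≤ fracConst α := by
  have hden : 0 < Real.Gamma (1 - α / 2) := Real.Gamma_pos_of_pos (by linarith)
  unfold fracConst
  positivity

/-- The symmetric second difference of `φ` at `x`. Its integral against `h ^ (-1 - α)` converges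
absolutely, unlike the principal value in the fractional Laplacian. -/
noncomputable def secondDiff (φ : ℝ → ℝ) (x h : ℝ) : ℝ := 2 * φ x - φ (x + h) - φ (x - h)

theorem secondDiff_zero (φ : ℝ → ℝ) (x : ℝ) : secondDiff φ x 0 = 0 := by
  rw [secondDiff, add_zero, sub_zero]
  ring

theorem secondDiff_neg (φ : ℝ → ℝ) (x h : ℝ) : secondDiff φ x (-h) = secondDiff φ x h := by
  rw [secondDiff, secondDiff, sub_neg_eq_add, ← sub_eq_add_neg, sub_right_comm]

theorem secondDiff_add (φ ψ : ℝ → ℝ) (x h : ℝ) :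
    secondDiff (φ + ψ) x h = secondDiff φ x h + secondDiff ψ x h := by
  simp only [secondDiff, Pi.add_apply]
  ring

theorem secondDiff_smul (c : ℝ) (φ : ℝ → ℝ) (x h : ℝ) :
    secondDiff (c • φ) x h = c * secondDiff φ x h := by
  simp only [secondDiff, Pi.smul_apply, smul_eq_mul]
  ring

theorem continuous_secondDiff (hφ : Continuous φ) :
    Continuous fun p : ℝ × ℝ => secondDiff φ p.1 p.2 := by
  unfold secondDiff
  fun_prop

theorem abs_secondDiff_le {M : ℝ} (hM : ∀ x, |φ x| ≤ M) (x h : ℝ) :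
    |secondDiff φ x h| ≤ 4 * M := by
  obtain ⟨hlo, hhi⟩ := abs_le.1 (hM x)
  obtain ⟨hlo_add, hhi_add⟩ := abs_le.1 (hM (x + h))
  obtain ⟨hlo_sub, hhi_sub⟩ := abs_le.1 (hM (x - h))
  rw [secondDiff, abs_le]
  constructor <;> linarith

theorem hasDerivAt_secondDiff (hφ : Differentiable ℝ φ) (x h : ℝ) :
    HasDerivAt (secondDiff φ x) (deriv φ (x - h) - deriv φ (x + h)) h := by
  have hadd := (hφ (x + h)).hasDerivAt.comp_const_add x h
  have hsub := (hφ (x - h)).hasDerivAt.comp_const_sub x h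
  exact ((hadd.const_sub (2 * φ x)).sub hsub).congr_deriv (by ring)

theorem abs_secondDiff_le_of_lipschitzWith (hφ : Differentiable ℝ φ) {K : NNReal}
    (hK : LipschitzWith K (deriv φ)) (x h : ℝ) : |secondDiff φ x h| ≤ 2 * K * h ^ 2 := by
  wlog hh : 0 ≤ h
  · rw [← secondDiff_neg, ← neg_sq]
    exact this hφ hK x (-h) (by linarith)
  have hderiv : ∀ r ∈ Ico 0 h, ‖deriv φ (x - r) - deriv φ (x + r)‖ ≤ 2 * K * h := by
    intro r hr
    calc ‖deriv φ (x - r) - deriv φ (x + r)‖ ≤ K * ‖x - r - (x + r)‖ := hK.norm_sub_le _ _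
      _ = K * (2 * r) := by
        rw [show x - r - (x + r) = -(2 * r) by ring, norm_neg,
          Real.norm_of_nonneg (mul_nonneg zero_le_two hr.1)]
      _ ≤ K * (2 * h) := by gcongr; exact hr.2.le
      _ = 2 * K * h := by ring
  have hle := norm_image_sub_le_of_norm_deriv_le_segment'
    (fun r _ => (hasDerivAt_secondDiff hφ x r).hasDerivWithinAt) hderiv h ⟨hh, le_rfl⟩
  rw [secondDiff_zero, sub_zero, sub_zero, Real.norm_eq_abs] at hle
  exact hle.trans_eq (by ring)

theorem exists_abs_secondDiff_le (hφ : ContDiff ℝ 2 φ) (hs : HasCompactSupport φ) :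
    ∃ C, ∀ x h, |secondDiff φ x h| ≤ C * min 1 (h ^ 2) := by
  obtain ⟨M, hM⟩ := hs.exists_bound_of_continuous hφ.continuous
  have hφ' : ContDiff ℝ 1 (deriv φ) := ContDiff.deriv' (hφ.of_le one_add_one_eq_two.le)
  obtain ⟨K, hK⟩ := hφ'.lipschitzWith_of_hasCompactSupport hs.deriv one_ne_zero
  refine ⟨max (4 * M) (2 * K), fun x h => ?_⟩
  rcases le_total 1 (h ^ 2) with hh | hh
  · rw [min_eq_left hh, mul_one]
    exact (abs_secondDiff_le hM x h).trans (le_max_left _ _)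
  · rw [min_eq_right hh]
    exact (abs_secondDiff_le_of_lipschitzWith (hφ.differentiable two_ne_zero) hK x h).trans
      (mul_le_mul_of_nonneg_right (le_max_right _ _) (sq_nonneg h))

theorem integrableOn_kernel (hα₀ : 0 < α) (hα₂ : α < 2) :
    IntegrableOn (fun h : ℝ => min 1 (h ^ 2) / h ^ (1 + α)) (Ioi 0) := by
  have hmeas : Measurable (fun h : ℝ => min 1 (h ^ 2) / h ^ (1 + α)) := by fun_prop
  have hnorm : ∀ {h : ℝ}, 0 < h →
      ‖min 1 (h ^ 2) / h ^ (1 + α)‖ = min 1 (h ^ 2) * h ^ (-(1 + α)) := fun {h} hh => by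
    rw [Real.norm_of_nonneg (by positivity), Real.rpow_neg hh.le, div_eq_mul_inv]
  have hnear : IntegrableOn (fun h : ℝ => h ^ (1 - α)) (Ioc 0 1) :=
    (intervalIntegrable_iff_integrableOn_Ioc_of_le zero_le_one).1
      (intervalIntegral.intervalIntegrable_rpow' (by linarith))
  have hfar : IntegrableOn (fun h : ℝ => h ^ (-(1 + α))) (Ioi 1) :=
    integrableOn_Ioi_rpow_of_lt (by linarith) one_pos
  rw [← Ioc_union_Ioi_eq_Ioi (zero_le_one (α := ℝ))]
  refine IntegrableOn.union (hnear.mono' hmeas.aestronglyMeasurable ?_)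
    (hfar.mono' hmeas.aestronglyMeasurable ?_)
  · filter_upwards [ae_restrict_mem measurableSet_Ioc] with h hh
    calc ‖min 1 (h ^ 2) / h ^ (1 + α)‖ = min 1 (h ^ 2) * h ^ (-(1 + α)) := hnorm hh.1
      _ ≤ h ^ (2 : ℝ) * h ^ (-(1 + α)) := by
        rw [Real.rpow_two]
        exact mul_le_mul_of_nonneg_right (min_le_right _ _) (Real.rpow_nonneg hh.1.le _)
      _ = h ^ (1 - α) := by rw [← Real.rpow_add hh.1]; ring_nf
  · filter_upwards [ae_restrict_mem measurableSet_Ioi] with h hh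
    have hh₀ : 0 < h := one_pos.trans hh
    rw [hnorm hh₀]
    exact mul_le_of_le_one_left (Real.rpow_nonneg hh₀.le _) (min_le_left _ _)

/-- The fractional Laplacian without its normalizing constant, as an absolutely convergent
integral. -/
noncomputable def fracIntegral (α : ℝ) (φ : ℝ → ℝ) (x : ℝ) : ℝ :=
  ∫ h in Ioi (0 : ℝ), secondDiff φ x h / h ^ (1 + α)

theorem measurable_secondDiff_div_rpow (hφ : Continuous φ) (α : ℝ) :
    Measurable fun p : ℝ × ℝ => secondDiff φ p.1 p.2 / p.2 ^ (1 + α) :=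
  (continuous_secondDiff hφ).measurable.div (by fun_prop)

theorem norm_secondDiff_div_rpow_le {C : ℝ}
    (hC : ∀ x h, |secondDiff φ x h| ≤ C * min 1 (h ^ 2)) (x : ℝ) {h : ℝ} (hh : 0 < h) :
    ‖secondDiff φ x h / h ^ (1 + α)‖ ≤ C * (min 1 (h ^ 2) / h ^ (1 + α)) := by
  have hpow : 0 < h ^ (1 + α) := Real.rpow_pos_of_pos hh _
  rw [norm_div, Real.norm_of_nonneg hpow.le, mul_div_assoc']
  exact div_le_div_of_nonneg_right (hC x h) hpow.le

theorem integrableOn_secondDiff_div_rpow (hα₀ : 0 < α) (hα₂ : α < 2) (hφ : ContDiff ℝ 2 φ)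
    (hs : HasCompactSupport φ) (x : ℝ) :
    IntegrableOn (fun h : ℝ => secondDiff φ x h / h ^ (1 + α)) (Ioi 0) := by
  obtain ⟨C, hC⟩ := exists_abs_secondDiff_le hφ hs
  refine ((integrableOn_kernel hα₀ hα₂).const_mul C).mono'
    ((measurable_secondDiff_div_rpow hφ.continuous α).comp
      measurable_prodMk_left).aestronglyMeasurable ?_
  filter_upwards [ae_restrict_mem measurableSet_Ioi] with h hh
  exact norm_secondDiff_div_rpow_le hC x hh

theorem measurable_fracIntegral (hφ : Continuous φ) (α : ℝ) : Measurable (fracIntegral α φ) :=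
  ((measurable_secondDiff_div_rpow hφ α).stronglyMeasurable.integral_prod_right').measurable

theorem exists_norm_fracIntegral_le (hα₀ : 0 < α) (hα₂ : α < 2) (hφ : ContDiff ℝ 2 φ)
    (hs : HasCompactSupport φ) : ∃ C, ∀ x, ‖fracIntegral α φ x‖ ≤ C := by
  obtain ⟨C, hC⟩ := exists_abs_secondDiff_le hφ hs
  refine ⟨∫ h in Ioi (0 : ℝ), C * (min 1 (h ^ 2) / h ^ (1 + α)), fun x => ?_⟩
  refine norm_integral_le_of_norm_le ((integrableOn_kernel hα₀ hα₂).const_mul C) ?_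
  filter_upwards [ae_restrict_mem measurableSet_Ioi] with h hh
  exact norm_secondDiff_div_rpow_le hC x hh

theorem fracIntegral_add (hα₀ : 0 < α) (hα₂ : α < 2) (hφ : ContDiff ℝ 2 φ)
    (hs : HasCompactSupport φ) (hψ : ContDiff ℝ 2 ψ) (ht : HasCompactSupport ψ) :
    fracIntegral α (φ + ψ) = fracIntegral α φ + fracIntegral α ψ := by
  ext x
  simp only [fracIntegral, secondDiff_add, add_div, Pi.add_apply]
  exact integral_add (integrableOn_secondDiff_div_rpow hα₀ hα₂ hφ hs x)
    (integrableOn_secondDiff_div_rpow hα₀ hα₂ hψ ht x)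

theorem fracIntegral_smul (α c : ℝ) (φ : ℝ → ℝ) :
    fracIntegral α (c • φ) = c • fracIntegral α φ := by
  ext x
  simp only [fracIntegral, secondDiff_smul, mul_div_assoc, integral_const_mul, Pi.smul_apply,
    smul_eq_mul]

theorem integrable_indicator_div_rpow (hα₀ : 0 < α) {δ : ℝ} (hδ : 0 < δ) {q : ℝ → ℝ}
    (hq : Measurable q) {M : ℝ} (hM : ∀ h, |q h| ≤ M) :
    Integrable ({h : ℝ | δ ≤ |h|}.indicator fun h => q h / |h| ^ (1 + α)) := by
  have hset : MeasurableSet {h : ℝ | δ ≤ |h|} := measurableSet_le measurable_const (by fun_prop)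
  have hM₀ : 0 ≤ M := (abs_nonneg _).trans (hM 0)
  have hdecay : Integrable fun h : ℝ => (1 + ‖h‖) ^ (-(1 + α)) :=
    integrable_one_add_norm (by rw [Module.finrank_self, Nat.cast_one]; linarith)
  refine (hdecay.const_mul (M * (1 / δ + 1) ^ (1 + α))).mono'
    ((hq.div (by fun_prop)).indicator hset).aestronglyMeasurable (ae_of_all _ fun h => ?_)
  rw [norm_indicator_eq_indicator_norm]
  refine indicator_apply_le' (fun hh : δ ≤ |h| => ?_) fun _ => by positivity
  have hpos : 0 < |h| := hδ.trans_le hh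
  have hbase : |h|⁻¹ ≤ (1 / δ + 1) / (1 + |h|) := by
    have hone : 1 ≤ |h| * (1 / δ) := by rwa [mul_one_div, le_div_iff₀ hδ, one_mul]
    rw [le_div_iff₀ (by positivity), inv_mul_le_iff₀ hpos]
    linarith
  calc ‖q h / |h| ^ (1 + α)‖ = |q h| * |h|⁻¹ ^ (1 + α) := by
        rw [norm_div, Real.norm_eq_abs, Real.norm_of_nonneg (by positivity),
          Real.inv_rpow hpos.le, div_eq_mul_inv]
    _ ≤ M * ((1 / δ + 1) / (1 + |h|)) ^ (1 + α) :=
        mul_le_mul (hM h) (Real.rpow_le_rpow (by positivity) hbase (by linarith)) (by positivity)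
          hM₀
    _ = M * (1 / δ + 1) ^ (1 + α) * (1 + ‖h‖) ^ (-(1 + α)) := by
        rw [Real.div_rpow (by positivity) (by positivity), Real.norm_eq_abs,
          Real.rpow_neg (by positivity), div_eq_mul_inv, mul_assoc]

theorem setIntegral_sub_div_rpow (hα₀ : 0 < α) (hφ : Continuous φ) (hs : HasCompactSupport φ)
    (x : ℝ) {δ : ℝ} (hδ : 0 < δ) :
    ∫ y in {y : ℝ | δ ≤ |x - y|}, (φ x - φ y) / |x - y| ^ (1 + α) =
      ∫ h in Ioi (0 : ℝ), (Ici δ).indicator (fun h => secondDiff φ x h / h ^ (1 + α)) h := by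
  obtain ⟨M, hM⟩ := hs.exists_bound_of_continuous hφ
  set k : ℝ → ℝ := {h : ℝ | δ ≤ |h|}.indicator fun h => (φ x - φ (x + h)) / |h| ^ (1 + α) with hk
  have hint : Integrable k := integrable_indicator_div_rpow hα₀ hδ (by fun_prop) fun h =>
    (abs_sub _ _).trans (add_le_add (hM x) (hM (x + h)))
  have htranslate : (fun h => {y : ℝ | δ ≤ |x - y|}.indicator
      (fun y => (φ x - φ y) / |x - y| ^ (1 + α)) (x + h)) = k := by
    ext h
    simp only [hk, indicator_apply, mem_ofPred_eq, sub_add_cancel_left, abs_neg]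
  have hreflect : ∫ h in Iic (0 : ℝ), k h = ∫ h in Ioi (0 : ℝ), k (-h) := by
    rw [integral_comp_neg_Ioi 0 k, neg_zero]
  have hset : MeasurableSet {y : ℝ | δ ≤ |x - y|} :=
    measurableSet_le measurable_const (by fun_prop)
  rw [← integral_indicator hset, ← integral_add_left_eq_self _ x, htranslate,
    ← intervalIntegral.integral_Iic_add_Ioi (b := 0) hint.integrableOn hint.integrableOn,
    hreflect, ← integral_add hint.comp_neg.integrableOn hint.integrableOn]
  refine setIntegral_congr_fun measurableSet_Ioi fun h hh => ?_
  simp only [hk, indicator_apply, mem_ofPred_eq, abs_neg, abs_of_pos (mem_Ioi.1 hh), mem_Ici,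
    secondDiff]
  split_ifs
  · rw [← add_div, ← sub_eq_add_neg]
    ring
  · exact add_zero 0

theorem tendsto_setIntegral_indicator_Ici {q : ℝ → ℝ} (hq : IntegrableOn q (Ioi 0)) :
    Tendsto (fun δ => ∫ h in Ioi (0 : ℝ), (Ici δ).indicator q h) (𝓝[>] 0)
      (𝓝 (∫ h in Ioi (0 : ℝ), q h)) := by
  refine tendsto_integral_filter_of_dominated_convergence (fun h => ‖q h‖)
    (.of_forall fun δ => hq.aestronglyMeasurable.indicator measurableSet_Ici)
    (.of_forall fun δ => ae_of_all _ fun h => norm_indicator_le_norm_self _ _) hq.norm ?_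
  filter_upwards [ae_restrict_mem measurableSet_Ioi] with h hh
  refine tendsto_const_nhds.congr' ?_
  filter_upwards [mem_nhdsWithin_of_mem_nhds (Iio_mem_nhds hh)] with δ hδ
  rw [indicator_of_mem (mem_Ici.2 (le_of_lt hδ))]

theorem fracLaplacian_eq_fracIntegral (hα₀ : 0 < α) (hα₂ : α < 2) (hφ : ContDiff ℝ 2 φ)
    (hs : HasCompactSupport φ) (x : ℝ) :
    fracLaplacian α φ x = fracConst α * fracIntegral α φ x := by
  refine congrArg _ (Tendsto.limUnder_eq ?_)
  refine (tendsto_setIntegral_indicator_Ici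
    (integrableOn_secondDiff_div_rpow hα₀ hα₂ hφ hs x)).congr' ?_
  filter_upwards [self_mem_nhdsWithin] with δ hδ
  exact (setIntegral_sub_div_rpow hα₀ hφ.continuous hs x hδ).symm

/-- The Gagliardo form `∫∫ (ψ x - ψ y) (φ x - φ y) / |x - y|^(1 + α)` over `x < y`, written with
`y = x + h`. -/
noncomputable def gagliardoForm (α : ℝ) (ψ φ : ℝ → ℝ) : ℝ :=
  ∫ h in Ioi (0 : ℝ), (∫ x, (ψ x - ψ (x + h)) * (φ x - φ (x + h))) / h ^ (1 + α)

theorem gagliardoForm_comm (α : ℝ) (ψ φ : ℝ → ℝ) :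
    gagliardoForm α ψ φ = gagliardoForm α φ ψ := by
  simp only [gagliardoForm, mul_comm]

theorem gagliardoForm_self_nonneg (α : ℝ) (φ : ℝ → ℝ) : 0 ≤ gagliardoForm α φ φ :=
  setIntegral_nonneg measurableSet_Ioi fun _ hh =>
    div_nonneg (integral_nonneg fun _ => mul_self_nonneg _) (Real.rpow_nonneg (le_of_lt hh) _)

theorem integral_mul_secondDiff (hφ : Continuous φ) (hs : HasCompactSupport φ)
    (hψ : Continuous ψ) (h : ℝ) :
    ∫ x, ψ x * secondDiff φ x h = ∫ x, (ψ x - ψ (x + h)) * (φ x - φ (x + h)) := by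
  have hint : ∀ a b : ℝ, Integrable fun x => ψ (x + a) * φ (x + b) := fun a b =>
    Continuous.integrable_of_hasCompactSupport (by fun_prop)
      ((hs.comp_homeomorph (Homeomorph.addRight b)).mul_left)
  let I (a b : ℝ) : ℝ := ∫ x, ψ (x + a) * φ (x + b)
  have hI : ∀ a b c : ℝ, I (a + c) (b + c) = I a b := fun a b c => by
    refine Eq.trans ?_ (integral_add_right_eq_self (fun x => ψ (x + a) * φ (x + b)) c)
    simp only [I, add_assoc, add_comm c]
  have hleft : ∫ x, ψ x * secondDiff φ x h = I 0 0 + I 0 0 - I 0 h - I 0 (-h) := by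
    rw [← integral_add' (hint 0 0) (hint 0 0),
      ← integral_sub' ((hint 0 0).add (hint 0 0)) (hint 0 h),
      ← integral_sub' (((hint 0 0).add (hint 0 0)).sub (hint 0 h)) (hint 0 (-h))]
    refine integral_congr_ae (ae_of_all _ fun x => ?_)
    simp only [secondDiff, Pi.add_apply, Pi.sub_apply, add_zero, ← sub_eq_add_neg]
    ring
  have hright : ∫ x, (ψ x - ψ (x + h)) * (φ x - φ (x + h)) =
      I 0 0 - I 0 h - I h 0 + I h h := by
    rw [← integral_sub' (hint 0 0) (hint 0 h),
      ← integral_sub' ((hint 0 0).sub (hint 0 h)) (hint h 0),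
      ← integral_add' (((hint 0 0).sub (hint 0 h)).sub (hint h 0)) (hint h h)]
    refine integral_congr_ae (ae_of_all _ fun x => ?_)
    simp only [Pi.add_apply, Pi.sub_apply, add_zero]
    ring
  have hIh : I h 0 = I 0 (-h) := by simpa using hI 0 (-h) h
  have hIhh : I h h = I 0 0 := by simpa using hI 0 0 h
  rw [hleft, hright, hIh, hIhh]
  ring

theorem integral_mul_fracIntegral (hα₀ : 0 < α) (hα₂ : α < 2) (hφ : ContDiff ℝ 2 φ)
    (hs : HasCompactSupport φ) (hψ : Continuous ψ) (hψ_int : Integrable ψ) :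
    ∫ x, ψ x * fracIntegral α φ x = gagliardoForm α ψ φ := by
  obtain ⟨C, hC⟩ := exists_abs_secondDiff_le hφ hs
  have hint : Integrable (Function.uncurry fun x h => ψ x * (secondDiff φ x h / h ^ (1 + α)))
      (volume.prod (volume.restrict (Ioi 0))) := by
    refine (hψ_int.norm.mul_prod ((integrableOn_kernel hα₀ hα₂).const_mul C)).mono'
      ((hψ.measurable.comp measurable_fst).mul
        (measurable_secondDiff_div_rpow hφ.continuous α)).aestronglyMeasurable ?_
    filter_upwards [Measure.quasiMeasurePreserving_snd.ae (ae_restrict_mem measurableSet_Ioi)]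
      with p hp
    rw [Function.uncurry, norm_mul]
    exact mul_le_mul_of_nonneg_left (norm_secondDiff_div_rpow_le hC _ hp) (norm_nonneg _)
  simp only [fracIntegral, ← integral_const_mul]
  rw [integral_integral_swap hint]
  simp only [gagliardoForm, ← integral_mul_secondDiff hφ.continuous hs hψ, ← integral_div,
    mul_div_assoc]

theorem sq_intervalIntegral_le {q : ℝ → ℝ} (hq : Continuous q) {a b : ℝ} (hab : a ≤ b) :
    (∫ s in a..b, q s) ^ 2 ≤ (b - a) * ∫ s in a..b, q s ^ 2 := by
  have hquad : ∀ c, 0 ≤ (b - a) * (c * c) + 2 * (∫ s in a..b, q s) * c +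
      ∫ s in a..b, q s ^ 2 := fun c => by
    have hint : ∀ {r : ℝ → ℝ}, Continuous r → IntervalIntegrable r volume a b :=
      fun hr => hr.intervalIntegrable a b
    calc 0 ≤ ∫ s in a..b, (c + q s) ^ 2 :=
          intervalIntegral.integral_nonneg hab fun s _ => sq_nonneg _
      _ = ∫ s in a..b, (c * c + 2 * c * q s + q s ^ 2) := by simp only [add_sq, sq c]
      _ = _ := by
        rw [intervalIntegral.integral_add (hint (by fun_prop)) (hint (by fun_prop)),
          intervalIntegral.integral_add (hint (by fun_prop)) (hint (by fun_prop)),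
          intervalIntegral.integral_const, intervalIntegral.integral_const_mul, smul_eq_mul]
        ring
  have hdiscrim := discrim_le_zero hquad
  rw [discrim] at hdiscrim
  linarith

theorem sq_sub_le_mul_integral_deriv_sq (hφ : ContDiff ℝ 1 φ) (x : ℝ) {h : ℝ} (hh : 0 ≤ h) :
    (φ x - φ (x + h)) ^ 2 ≤ h * ∫ s in (0 : ℝ)..h, deriv φ (x + s) ^ 2 := by
  have hφ' : Continuous (deriv φ) := hφ.continuous_deriv le_rfl
  have hFTC : ∫ s in (0 : ℝ)..h, deriv φ (x + s) = φ (x + h) - φ x := by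
    rw [intervalIntegral.integral_comp_add_left (deriv φ), add_zero,
      intervalIntegral.integral_deriv_eq_sub (fun y _ => hφ.differentiable one_ne_zero y)
        (hφ'.intervalIntegrable _ _)]
  have hle := sq_intervalIntegral_le (q := fun s => deriv φ (x + s)) (by fun_prop) hh
  rwa [hFTC, sub_zero, sub_sq_comm] at hle

theorem integrable_sq (hφ : Continuous φ) (hs : HasCompactSupport φ) :
    Integrable fun x => φ x ^ 2 :=
  Continuous.integrable_of_hasCompactSupport (by fun_prop)
    (hs.comp_left (g := fun y => y ^ 2) (zero_pow two_ne_zero))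

theorem integral_sq_sub_le_sq_mul (hφ : ContDiff ℝ 1 φ) (hs : HasCompactSupport φ) {h : ℝ}
    (hh : 0 ≤ h) : ∫ x, (φ x - φ (x + h)) ^ 2 ≤ h ^ 2 * ∫ x, deriv φ x ^ 2 := by
  have hφ' : Continuous (deriv φ) := hφ.continuous_deriv le_rfl
  have hint : Integrable (Function.uncurry fun x s : ℝ => deriv φ (x + s) ^ 2)
      (volume.prod (volume.restrict (Ioc 0 h))) := by
    refine (integrable_prod_iff' (Continuous.aestronglyMeasurable (by fun_prop))).2
      ⟨ae_of_all _ fun s => (integrable_sq hφ' hs.deriv).comp_add_right s, ?_⟩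
    simp only [Function.uncurry]
    simp only [integral_add_right_eq_self (fun x => ‖deriv φ x ^ 2‖)]
    exact integrable_const _
  have hswap : ∫ x, ∫ s in (0 : ℝ)..h, deriv φ (x + s) ^ 2 = h * ∫ x, deriv φ x ^ 2 := by
    simp only [intervalIntegral.integral_of_le hh]
    rw [integral_integral_swap hint]
    simp only [integral_add_right_eq_self (fun x => deriv φ x ^ 2), integral_const,
      MeasurableSet.univ, measureReal_restrict_apply, univ_inter, Real.volume_real_Ioc_of_le hh,
      sub_zero, smul_eq_mul]
  have hint_right : Integrable fun x => ∫ s in (0 : ℝ)..h, deriv φ (x + s) ^ 2 := by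
    simp only [intervalIntegral.integral_of_le hh]
    exact hint.integral_prod_left
  calc ∫ x, (φ x - φ (x + h)) ^ 2 ≤ ∫ x, h * ∫ s in (0 : ℝ)..h, deriv φ (x + s) ^ 2 :=
        integral_mono_of_nonneg (ae_of_all _ fun x => sq_nonneg _) (hint_right.const_mul h)
          (ae_of_all _ fun x => sq_sub_le_mul_integral_deriv_sq hφ x hh)
    _ = h ^ 2 * ∫ x, deriv φ x ^ 2 := by rw [integral_const_mul, hswap, sq, mul_assoc]

theorem integral_sq_sub_le_four_mul (hφ : Integrable fun x => φ x ^ 2) (h : ℝ) :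
    ∫ x, (φ x - φ (x + h)) ^ 2 ≤ 4 * ∫ x, φ x ^ 2 := by
  have hφh : Integrable fun x => φ (x + h) ^ 2 := hφ.comp_add_right h
  calc ∫ x, (φ x - φ (x + h)) ^ 2 ≤ ∫ x, (2 * φ x ^ 2 + 2 * φ (x + h) ^ 2) :=
        integral_mono_of_nonneg (ae_of_all _ fun x => sq_nonneg _)
          ((hφ.const_mul 2).add (hφh.const_mul 2))
          (ae_of_all _ fun x => by nlinarith [sq_nonneg (φ x + φ (x + h))])
    _ = 4 * ∫ x, φ x ^ 2 := by
        rw [integral_add (hφ.const_mul 2) (hφh.const_mul 2), integral_const_mul,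
          integral_const_mul, integral_add_right_eq_self (fun x => φ x ^ 2) h]
        ring

theorem integral_sq_sub_le (hφ : ContDiff ℝ 1 φ) (hs : HasCompactSupport φ) {h : ℝ}
    (hh : 0 ≤ h) : ∫ x, (φ x - φ (x + h)) ^ 2 ≤
      min 1 (h ^ 2) * (4 * ((∫ x, φ x ^ 2) + ∫ x, deriv φ x ^ 2)) := by
  have hnonneg : ∀ q : ℝ → ℝ, 0 ≤ ∫ x, q x ^ 2 := fun q => integral_nonneg fun x => sq_nonneg _
  rcases le_total 1 (h ^ 2) with h_le | h_le
  · rw [min_eq_left h_le, one_mul]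
    linarith [integral_sq_sub_le_four_mul (integrable_sq hφ.continuous hs) h, hnonneg (deriv φ)]
  · rw [min_eq_right h_le]
    refine (integral_sq_sub_le_sq_mul hφ hs hh).trans (mul_le_mul_of_nonneg_left ?_ (sq_nonneg h))
    linarith [hnonneg φ, hnonneg (deriv φ)]

theorem gagliardoForm_self_le (hα₀ : 0 < α) (hα₂ : α < 2) (hφ : ContDiff ℝ 1 φ)
    (hs : HasCompactSupport φ) : gagliardoForm α φ φ ≤
      (∫ h in Ioi (0 : ℝ), min 1 (h ^ 2) / h ^ (1 + α)) *
        (4 * ((∫ x, φ x ^ 2) + ∫ x, deriv φ x ^ 2)) := by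
  rw [← integral_mul_const]
  refine integral_mono_of_nonneg ?_ ((integrableOn_kernel hα₀ hα₂).mul_const _) ?_
  · filter_upwards [ae_restrict_mem measurableSet_Ioi] with h hh
    exact div_nonneg (integral_nonneg fun x => mul_self_nonneg _)
      (Real.rpow_nonneg (le_of_lt hh) _)
  · filter_upwards [ae_restrict_mem measurableSet_Ioi] with h hh
    rw [div_mul_eq_mul_div]
    simp only [← sq]
    exact div_le_div_of_nonneg_right (integral_sq_sub_le hφ hs (le_of_lt hh))
      (Real.rpow_nonneg (le_of_lt hh) _)

end FractionalLaplacian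

/-! ### The operator `A_ε` -/

section Operator

variable {α ε : ℝ}

instance : IsFiniteMeasure μΩ := by
  unfold μΩ Ω
  infer_instance

theorem IsTestFunction.contDiff_two {φ : ℝ → ℝ} (hφ : IsTestFunction φ) : ContDiff ℝ 2 φ :=
  contDiff_infty.1 hφ.smooth 2

theorem IsTestFunction.differentiable {φ : ℝ → ℝ} (hφ : IsTestFunction φ) :
    Differentiable ℝ φ :=
  hφ.contDiff_two.differentiable two_ne_zero

theorem IsTestFunction.deriv {φ : ℝ → ℝ} (hφ : IsTestFunction φ) : IsTestFunction (deriv φ) where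
  smooth := (contDiff_infty_iff_deriv.1 hφ.smooth).2
  compactSupport := hφ.compactSupport.deriv
  support_subset :=
    (closure_minimal support_deriv_subset (isClosed_tsupport φ)).trans hφ.support_subset

theorem IsTestFunction.integral_Ω_mul {φ : ℝ → ℝ} (hφ : IsTestFunction φ) (q : ℝ → ℝ) :
    ∫ x in Ω, φ x * q x = ∫ x, φ x * q x :=
  setIntegral_eq_integral_of_forall_compl_eq_zero fun x hx => by
    rw [image_eq_zero_of_notMem_tsupport fun h => hx (hφ.support_subset h), zero_mul]

theorem IsTestFunction.integrable {φ : ℝ → ℝ} (hφ : IsTestFunction φ) : Integrable φ :=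
  hφ.smooth.continuous.integrable_of_hasCompactSupport hφ.compactSupport

theorem IsTestFunction.integrable_mul {φ ψ : ℝ → ℝ} (hφ : IsTestFunction φ)
    (hψ : IsTestFunction ψ) : Integrable (φ * ψ) :=
  (hφ.smooth.continuous.mul hψ.smooth.continuous).integrable_of_hasCompactSupport
    hψ.compactSupport.mul_left

theorem IsTestFunction.memLp {φ : ℝ → ℝ} (hφ : IsTestFunction φ) : MemLp φ 2 μΩ :=
  (hφ.smooth.continuous.memLp_of_hasCompactSupport hφ.compactSupport).restrict _

theorem IsTestFunction.memLp_fracIntegral (hα₀ : 0 < α) (hα₂ : α < 2) {φ : ℝ → ℝ}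
    (hφ : IsTestFunction φ) : MemLp (fracIntegral α φ) 2 μΩ := by
  obtain ⟨C, hC⟩ := exists_norm_fracIntegral_le hα₀ hα₂ hφ.contDiff_two hφ.compactSupport
  exact MemLp.of_bound (measurable_fracIntegral hφ.smooth.continuous α).aestronglyMeasurable C
    (ae_of_all _ hC)

/-- The space `C_c^∞(Ω)`. -/
def testFunctions : Submodule ℝ (ℝ → ℝ) where
  carrier := {φ | IsTestFunction φ}
  add_mem' {φ ψ} hφ hψ :=
    ⟨hφ.smooth.add hψ.smooth, hφ.compactSupport.add hψ.compactSupport,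
      (tsupport_add φ ψ).trans (union_subset hφ.support_subset hψ.support_subset)⟩
  zero_mem' := ⟨contDiff_const, HasCompactSupport.zero, by simp⟩
  smul_mem' c φ hφ :=
    ⟨hφ.smooth.const_smul c, hφ.compactSupport.smul_left (f := fun _ => c),
      (tsupport_smul_subset_right (fun _ => c) φ).trans hφ.support_subset⟩

theorem isTestFunction_coe (φ : testFunctions) : IsTestFunction φ := φ.2

/-- Differentiation of test functions. -/
noncomputable def testDeriv : testFunctions →ₗ[ℝ] testFunctions where
  toFun φ := ⟨deriv φ, (isTestFunction_coe φ).deriv⟩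
  map_add' φ ψ := by
    ext x
    exact deriv_add ((isTestFunction_coe φ).differentiable x)
      ((isTestFunction_coe ψ).differentiable x)
  map_smul' c φ := by
    ext x
    exact deriv_const_smul c ((isTestFunction_coe φ).differentiable x)

/-- The embedding of `C_c^∞(Ω)` into `L²(Ω)`. -/
noncomputable def testToLp : testFunctions →ₗ[ℝ] H where
  toFun φ := (isTestFunction_coe φ).memLp.toLp φ
  map_add' _ _ := rfl
  map_smul' _ _ := rfl

/-- The fractional Laplacian of test functions, without its normalizing constant, with values in
`L²(Ω)`. -/
noncomputable def fracToLp (hα₀ : 0 < α) (hα₂ : α < 2) : testFunctions →ₗ[ℝ] H where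
  toFun φ := ((isTestFunction_coe φ).memLp_fracIntegral hα₀ hα₂).toLp _
  map_add' φ ψ := by
    have hφ := isTestFunction_coe φ
    have hψ := isTestFunction_coe ψ
    rw [← MemLp.toLp_add]
    exact MemLp.toLp_congr _ _ (.of_eq (fracIntegral_add hα₀ hα₂ hφ.contDiff_two hφ.compactSupport
      hψ.contDiff_two hψ.compactSupport))
  map_smul' c φ := by
    rw [RingHom.id_apply, ← MemLp.toLp_const_smul]
    exact MemLp.toLp_congr _ _ (.of_eq (fracIntegral_smul α c φ))

/-- The operator `-ε Δ + (-Δ)^(α/2)` on test functions, with values in `L²(Ω)`. -/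
noncomputable def testOperator (ε : ℝ) (hα₀ : 0 < α) (hα₂ : α < 2) : testFunctions →ₗ[ℝ] H :=
  (-ε) • (testToLp ∘ₗ testDeriv ∘ₗ testDeriv) + fracConst α • fracToLp hα₀ hα₂

theorem coeFn_testToLp (φ : testFunctions) : (testToLp φ : ℝ → ℝ) =ᵐ[μΩ] φ :=
  (isTestFunction_coe φ).memLp.coeFn_toLp

theorem coeFn_fracToLp (hα₀ : 0 < α) (hα₂ : α < 2) (φ : testFunctions) :
    (fracToLp hα₀ hα₂ φ : ℝ → ℝ) =ᵐ[μΩ] fracIntegral α φ :=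
  ((isTestFunction_coe φ).memLp_fracIntegral hα₀ hα₂).coeFn_toLp

theorem testOperator_apply (ε : ℝ) (hα₀ : 0 < α) (hα₂ : α < 2) (φ : testFunctions) :
    testOperator ε hα₀ hα₂ φ =
      (-ε) • testToLp (testDeriv (testDeriv φ)) + fracConst α • fracToLp hα₀ hα₂ φ := rfl

theorem coeFn_testOperator (ε : ℝ) (hα₀ : 0 < α) (hα₂ : α < 2) (φ : testFunctions) :
    (testOperator ε hα₀ hα₂ φ : ℝ → ℝ) =ᵐ[μΩ]
      fun x => -ε * iteratedDeriv 2 φ x + fracLaplacian α φ x := by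
  rw [testOperator_apply]
  filter_upwards [Lp.coeFn_add ((-ε) • testToLp (testDeriv (testDeriv φ)))
    (fracConst α • fracToLp hα₀ hα₂ φ), Lp.coeFn_smul (-ε) (testToLp (testDeriv (testDeriv φ))),
    Lp.coeFn_smul (fracConst α) (fracToLp hα₀ hα₂ φ), coeFn_testToLp (testDeriv (testDeriv φ)),
    coeFn_fracToLp hα₀ hα₂ φ] with x hadd hsmul hsmul_frac hderiv hfrac
  rw [hadd, Pi.add_apply, hsmul, hsmul_frac, Pi.smul_apply, Pi.smul_apply, hderiv, hfrac,
    fracLaplacian_eq_fracIntegral hα₀ hα₂ (isTestFunction_coe φ).contDiff_two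
      (isTestFunction_coe φ).compactSupport, iteratedDeriv_succ, iteratedDeriv_one]
  rfl

theorem inner_eq_setIntegral {u w : H} {a b : ℝ → ℝ} (hu : (u : ℝ → ℝ) =ᵐ[μΩ] a)
    (hw : (w : ℝ → ℝ) =ᵐ[μΩ] b) : inner ℝ u w = ∫ x in Ω, a x * b x := by
  rw [L2.inner_def]
  refine integral_congr_ae ?_
  filter_upwards [hu, hw] with x hux hwx
  rw [hux, hwx, RCLike.inner_apply, conj_trivial, mul_comm]

theorem norm_sq_testToLp (φ : testFunctions) : ‖testToLp φ‖ ^ 2 = ∫ x, (φ : ℝ → ℝ) x ^ 2 := by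
  rw [← real_inner_self_eq_norm_sq, inner_eq_setIntegral (coeFn_testToLp φ) (coeFn_testToLp φ),
    (isTestFunction_coe φ).integral_Ω_mul]
  simp only [sq]

theorem inner_testDeriv (φ ψ : testFunctions) :
    inner ℝ (testToLp (testDeriv φ)) (testToLp ψ) =
      -inner ℝ (testToLp φ) (testToLp (testDeriv ψ)) := by
  have hφ := isTestFunction_coe φ
  have hψ := isTestFunction_coe ψ
  have hparts := integral_mul_deriv_eq_deriv_mul_of_integrable
    (fun x _ => (hφ.differentiable x).hasDerivAt) (fun x _ => (hψ.differentiable x).hasDerivAt)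
    (hφ.integrable_mul hψ.deriv) (hφ.deriv.integrable_mul hψ) (hφ.integrable_mul hψ)
  rw [inner_eq_setIntegral (coeFn_testToLp _) (coeFn_testToLp _),
    inner_eq_setIntegral (coeFn_testToLp _) (coeFn_testToLp _),
    (isTestFunction_coe (testDeriv φ)).integral_Ω_mul, hφ.integral_Ω_mul]
  exact (neg_eq_iff_eq_neg.2 hparts).symm

theorem inner_fracToLp (hα₀ : 0 < α) (hα₂ : α < 2) (φ ψ : testFunctions) :
    inner ℝ (fracToLp hα₀ hα₂ φ) (testToLp ψ) = gagliardoForm α ψ φ := by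
  have hφ := isTestFunction_coe φ
  have hψ := isTestFunction_coe ψ
  rw [real_inner_comm, inner_eq_setIntegral (coeFn_testToLp _) (coeFn_fracToLp hα₀ hα₂ _),
    hψ.integral_Ω_mul, integral_mul_fracIntegral hα₀ hα₂ hφ.contDiff_two hφ.compactSupport
      hψ.smooth.continuous hψ.integrable]

theorem inner_testOperator (ε : ℝ) (hα₀ : 0 < α) (hα₂ : α < 2) (φ ψ : testFunctions) :
    inner ℝ (testOperator ε hα₀ hα₂ φ) (testToLp ψ) =
      ε * inner ℝ (testToLp (testDeriv φ)) (testToLp (testDeriv ψ)) +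
        fracConst α * gagliardoForm α ψ φ := by
  rw [testOperator_apply, inner_add_left, real_inner_smul_left, real_inner_smul_left,
    inner_testDeriv, inner_fracToLp]
  ring

theorem inner_testOperator_symm (ε : ℝ) (hα₀ : 0 < α) (hα₂ : α < 2) (φ ψ : testFunctions) :
    inner ℝ (testOperator ε hα₀ hα₂ φ) (testToLp ψ) =
      inner ℝ (testToLp φ) (testOperator ε hα₀ hα₂ ψ) := by
  rw [real_inner_comm (testOperator ε hα₀ hα₂ ψ), inner_testOperator, inner_testOperator,
    real_inner_comm, gagliardoForm_comm]

theorem eq_zero_of_inner_testToLp {w : H} (h : ∀ φ, inner ℝ w (testToLp φ) = 0) : w = 0 := by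
  have hw : Integrable (w : ℝ → ℝ) μΩ := (Lp.memLp w).integrable one_le_two
  have hzero : ∀ᵐ x ∂μΩ, x ∈ Ω → (w : ℝ → ℝ) x = 0 := by
    refine isOpen_Ioo.ae_eq_zero_of_integral_contDiff_smul_eq_zero
      (hw.locallyIntegrable.locallyIntegrableOn _) fun φ hsmooth hcompact hsupport => ?_
    have hφ := h ⟨φ, hsmooth, hcompact, hsupport⟩
    rwa [real_inner_comm, inner_eq_setIntegral (coeFn_testToLp _) .rfl] at hφ
  refine (Lp.eq_zero_iff_ae_eq_zero).2 ?_
  filter_upwards [hzero, ae_restrict_mem measurableSet_Ioo] with x hx hxΩ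
  exact hx hxΩ

/-- The map `φ ↦ (φ, φ')` on test functions. -/
noncomputable def testPair : testFunctions →ₗ[ℝ] WithLp 2 (H × H) :=
  (WithLp.linearEquiv 2 ℝ (H × H)).symm.toLinearMap ∘ₗ testToLp.prod (testToLp ∘ₗ testDeriv)

/-- The Hilbert space `H₀¹(Ω)`, realized as the space of pairs `(u, u')`. -/
noncomputable def H01Space : Submodule ℝ (WithLp 2 (H × H)) :=
  (LinearMap.range testPair).topologicalClosure

instance : CompleteSpace H01Space :=
  (Submodule.isClosed_topologicalClosure _).completeSpace_coe

/-- The embedding of `C_c^∞(Ω)` into `H₀¹(Ω)`. -/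
noncomputable def testToH01 : testFunctions →ₗ[ℝ] H01Space :=
  testPair.codRestrict H01Space fun φ => Submodule.le_topologicalClosure _ ⟨φ, rfl⟩

/-- The embedding `(u, u') ↦ u` of `H₀¹(Ω)` into `L²(Ω)`. -/
noncomputable def H01ToLp : H01Space →L[ℝ] H :=
  WithLp.fstL 2 ℝ H H ∘L H01Space.subtypeL

theorem H01ToLp_testToH01 (φ : testFunctions) : H01ToLp (testToH01 φ) = testToLp φ := rfl

theorem norm_sq_testToH01 (φ : testFunctions) :
    ‖testToH01 φ‖ ^ 2 = ‖testToLp φ‖ ^ 2 + ‖testToLp (testDeriv φ)‖ ^ 2 :=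
  WithLp.prod_norm_sq_eq_of_L2 (testPair φ)

theorem denseRange_testToH01 : DenseRange testToH01 := by
  intro v
  have himage : ((↑) : H01Space → WithLp 2 (H × H)) '' range testToH01 = range testPair :=
    (range_comp _ _).symm
  rw [closure_subtype, himage]
  exact v.2

theorem inner_testOperator_self (ε : ℝ) (hα₀ : 0 < α) (hα₂ : α < 2) (φ : testFunctions) :
    inner ℝ (testOperator ε hα₀ hα₂ φ) (H01ToLp (testToH01 φ)) =
      ε * ‖testToLp (testDeriv φ)‖ ^ 2 + fracConst α * gagliardoForm α φ φ := by
  rw [H01ToLp_testToH01, inner_testOperator, real_inner_self_eq_norm_sq]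

theorem isFormCore_testOperator (hε : 0 < ε) (hα₀ : 0 < α) (hα₂ : α < 2) :
    IsFormCore testToH01 H01ToLp (testOperator ε hα₀ hα₂) where
  denseRange := denseRange_testToH01
  eq_zero _ := eq_zero_of_inner_testToLp
  symm := inner_testOperator_symm ε hα₀ hα₂
  nonneg φ := by
    have hgag := mul_nonneg (fracConst_nonneg hα₀ hα₂) (gagliardoForm_self_nonneg α φ)
    rw [inner_testOperator_self]
    positivity
  le_norm_sq := by
    refine ⟨ε + fracConst α * ((∫ h in Ioi (0 : ℝ), min 1 (h ^ 2) / h ^ (1 + α)) * 4), fun φ => ?_⟩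
    have hφ := isTestFunction_coe φ
    have hderiv : ‖testToLp (testDeriv φ)‖ ^ 2 = ∫ x, deriv (φ : ℝ → ℝ) x ^ 2 :=
      norm_sq_testToLp (testDeriv φ)
    have hgag := mul_le_mul_of_nonneg_left (gagliardoForm_self_le hα₀ hα₂
      (hφ.contDiff_two.of_le one_le_two) hφ.compactSupport) (fracConst_nonneg hα₀ hα₂)
    have hnorm := mul_nonneg hε.le (sq_nonneg ‖testToLp φ‖)
    rw [← norm_sq_testToLp, ← hderiv] at hgag
    rw [inner_testOperator_self, norm_sq_testToH01]
    linarith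
  norm_sq_le := by
    refine ⟨min ε 1, lt_min hε one_pos, fun φ => ?_⟩
    have hgag := mul_nonneg (fracConst_nonneg hα₀ hα₂) (gagliardoForm_self_nonneg α φ)
    have hfst := mul_le_mul_of_nonneg_right (min_le_right ε 1) (sq_nonneg ‖testToLp φ‖)
    have hsnd := mul_le_mul_of_nonneg_right (min_le_left ε 1) (sq_nonneg ‖testToLp (testDeriv φ)‖)
    rw [inner_testOperator_self, H01ToLp_testToH01, norm_sq_testToH01]
    linarith

theorem isH01WithDeriv_iff {u u' : H} :
    IsH01WithDeriv u u' ↔ WithLp.toLp 2 (u, u') ∈ H01Space := by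
  let e := (WithLp.prodContinuousLinearEquiv 2 ℝ H H).toHomeomorph
  have hrange : range testPair = e ⁻¹' {q : H × H | ∃ φ : ℝ → ℝ, IsTestFunction φ ∧
      (q.1 : ℝ → ℝ) =ᵐ[μΩ] φ ∧ (q.2 : ℝ → ℝ) =ᵐ[μΩ] deriv φ} := by
    ext q
    constructor
    · rintro ⟨φ, rfl⟩
      exact ⟨φ, φ.2, coeFn_testToLp φ, coeFn_testToLp (testDeriv φ)⟩
    · rintro ⟨φ, hφ, hfst, hsnd⟩
      exact ⟨⟨φ, hφ⟩, e.injective (Prod.ext (Lp.ext ((coeFn_testToLp _).trans hfst.symm))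
        (Lp.ext ((coeFn_testToLp _).trans hsnd.symm)))⟩
  change _ ↔ WithLp.toLp 2 (u, u') ∈ closure (range testPair)
  rw [hrange, ← e.preimage_closure]
  rfl

theorem mem_H01_iff {u : H} : u ∈ H01 ↔ ∃ v, H01ToLp v = u := by
  constructor
  · rintro ⟨u', h⟩
    exact ⟨⟨_, isH01WithDeriv_iff.1 h⟩, rfl⟩
  · rintro ⟨v, rfl⟩
    exact ⟨(v : WithLp 2 (H × H)).snd, isH01WithDeriv_iff.2 v.2⟩

theorem isAeps_iff_friedrichs (ε : ℝ) (hα₀ : 0 < α) (hα₂ : α < 2) (u w : H) :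
    IsAeps ε α u w ↔ friedrichs testToH01 H01ToLp (testOperator ε hα₀ hα₂) u w := by
  have hinner : ∀ φ : testFunctions, (inner ℝ u (testOperator ε hα₀ hα₂ φ) =
      inner ℝ w (testToLp φ)) ↔ ∫ x in Ω, u x * (-ε * iteratedDeriv 2 φ x + fracLaplacian α φ x) =
        ∫ x in Ω, w x * (φ : ℝ → ℝ) x := fun φ => by
    rw [inner_eq_setIntegral .rfl (coeFn_testOperator ε hα₀ hα₂ φ),
      inner_eq_setIntegral .rfl (coeFn_testToLp φ)]
  exact and_congr mem_H01_iff
    ⟨fun h φ => (hinner φ).2 (h φ φ.2), fun h φ hφ => (hinner ⟨φ, hφ⟩).1 (h ⟨φ, hφ⟩)⟩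

theorem isNonnegSelfAdjoint_isAeps (hε : 0 < ε) (hα₀ : 0 < α) (hα₂ : α < 2) :
    IsNonnegSelfAdjoint (IsAeps ε α) := by
  have heq : IsAeps ε α = friedrichs testToH01 H01ToLp (testOperator ε hα₀ hα₂) :=
    funext₂ fun u w => propext (isAeps_iff_friedrichs ε hα₀ hα₂ u w)
  exact heq ▸ (isFormCore_testOperator hε hα₀ hα₂).isNonnegSelfAdjoint_friedrichs

end Operator

/-! ### The superposition operator -/

section Nemytskii

variable {f : ℝ → ℝ}

/-- The element `c · 1_(0, η)` of `L²(Ω)`. -/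
noncomputable def pulse (η c : ℝ) : H :=
  indicatorConstLp 2 (measurableSet_Ioo (a := 0) (b := η)) (measure_ne_top μΩ _) c

theorem coeFn_pulse (η c : ℝ) : (pulse η c : ℝ → ℝ) =ᵐ[μΩ] (Ioo 0 η).indicator fun _ => c :=
  indicatorConstLp_coeFn

theorem norm_pulse {η : ℝ} (hη₀ : 0 ≤ η) (hηπ : η ≤ Real.pi) (c : ℝ) :
    ‖pulse η c‖ = |c| * √η := by
  have hsubset : Ioo 0 η ⊆ Ω := Ioo_subset_Ioo (neg_nonpos.2 Real.pi_pos.le) hηπ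
  have hμ : μΩ.real (Ioo 0 η) = η := by
    rw [μΩ, measureReal_restrict_apply measurableSet_Ioo, inter_eq_self_of_subset_left hsubset,
      Real.volume_real_Ioo_of_le hη₀, sub_zero]
  rw [pulse, norm_indicatorConstLp two_ne_zero ENNReal.ofNat_ne_top, hμ, Real.norm_eq_abs,
    Real.sqrt_eq_rpow, ENNReal.toReal_ofNat]

theorem pulse_sub_pulse (η a b : ℝ) : pulse η a - pulse η b = pulse η (a - b) := by
  refine Lp.ext ?_
  filter_upwards [Lp.coeFn_sub (pulse η a) (pulse η b), coeFn_pulse η a, coeFn_pulse η b,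
    coeFn_pulse η (a - b)] with x hsub ha hb hab
  rw [hsub, Pi.sub_apply, ha, hb, hab]
  by_cases hx : x ∈ Ioo 0 η <;> simp [hx]

theorem nemytskii_pulse_sub (hf : ∀ u : H, MemLp (fun x => f (u x)) 2 μΩ) (η a b : ℝ) :
    nemytskii f hf (pulse η a) - nemytskii f hf (pulse η b) = pulse η (f a - f b) := by
  refine Lp.ext ?_
  filter_upwards [Lp.coeFn_sub (nemytskii f hf (pulse η a)) (nemytskii f hf (pulse η b)),
    (hf (pulse η a)).coeFn_toLp, (hf (pulse η b)).coeFn_toLp, coeFn_pulse η a, coeFn_pulse η b,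
    coeFn_pulse η (f a - f b)] with x hsub hfa hfb ha hb hfab
  rw [hsub, Pi.sub_apply, nemytskii, nemytskii, hfa, hfb, ha, hb, hfab]
  by_cases hx : x ∈ Ioo 0 η <;> simp [hx]

theorem exists_forall_norm_pulse_lt (M : ℝ) {r : ℝ} (hr : 0 < r) :
    ∃ η > 0, η ≤ Real.pi ∧ ∀ c, |c| ≤ M → ‖pulse η c‖ < r := by
  have hlim : Tendsto (fun η : ℝ => M * √η) (𝓝[>] 0) (𝓝 0) := by
    have hcont : Continuous fun η : ℝ => M * √η := by fun_prop
    simpa using (hcont.tendsto 0).mono_left nhdsWithin_le_nhds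
  have hπ : ∀ᶠ η in 𝓝[>] (0 : ℝ), η ≤ Real.pi :=
    eventually_nhdsWithin_of_eventually_nhds (eventually_le_nhds Real.pi_pos)
  obtain ⟨η, hη, hηπ, hηr⟩ :=
    (eventually_mem_nhdsWithin.and (hπ.and (hlim.eventually_lt_const hr))).exists
  refine ⟨η, hη, hηπ, fun c hc => ?_⟩
  rw [norm_pulse (le_of_lt hη) hηπ]
  exact (mul_le_mul_of_nonneg_right hc η.sqrt_nonneg).trans_lt hηr

theorem lipschitzWith_of_lipschitzOnWith_nemytskii
    {hf : ∀ u : H, MemLp (fun x => f (u x)) 2 μΩ} {K : NNReal} {t : Set H} (ht : t ∈ 𝓝 0)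
    (hK : LipschitzOnWith K (nemytskii f hf) t) : LipschitzWith K f := by
  obtain ⟨r, hr, hrt⟩ := Metric.mem_nhds_iff.1 ht
  refine LipschitzWith.of_dist_le_mul fun a b => ?_
  obtain ⟨η, hη₀, hηπ, hη⟩ := exists_forall_norm_pulse_lt (max |a| |b|) hr
  have hmem : ∀ c, |c| ≤ max |a| |b| → pulse η c ∈ t := fun c hc =>
    hrt (mem_ball_zero_iff.2 (hη c hc))
  have hle := hK.dist_le_mul _ (hmem a (le_max_left _ _)) _ (hmem b (le_max_right _ _))
  rw [dist_eq_norm, dist_eq_norm, nemytskii_pulse_sub, pulse_sub_pulse, norm_pulse hη₀.le hηπ,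
    norm_pulse hη₀.le hηπ, ← mul_assoc] at hle
  exact le_of_mul_le_mul_right hle (Real.sqrt_pos.2 hη₀)

theorem lipschitzWith_nemytskii (hf : ∀ u : H, MemLp (fun x => f (u x)) 2 μΩ) {K : NNReal}
    (hK : LipschitzWith K f) : LipschitzWith K (nemytskii f hf) := by
  refine LipschitzWith.of_dist_le_mul fun u v => ?_
  rw [dist_eq_norm, dist_eq_norm]
  refine Lp.norm_le_mul_norm_of_ae_le_mul ?_
  filter_upwards [Lp.coeFn_sub (nemytskii f hf u) (nemytskii f hf v), Lp.coeFn_sub u v,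
    (hf u).coeFn_toLp, (hf v).coeFn_toLp] with x hsub hsub' hfu hfv
  rw [hsub, hsub', Pi.sub_apply, Pi.sub_apply, nemytskii, nemytskii, hfu, hfv]
  exact hK.norm_sub_le _ _

end Nemytskii

/-! ### The semilinear equation -/

section Semilinear

variable {A : H → H → Prop} {F : H → H} {g u₀ : H} {L : NNReal} {T : ℝ} {u v : ℝ → H}

theorem IsMAccretive.isExpNeg (hA : IsMAccretive A) : IsExpNeg A (semigroup A) :=
  ⟨⟨hA.semigroup_zero, fun _ _ hs ht => hA.semigroup_add hs ht,
    fun x => (hA.continuous_semigroup_apply x).continuousOn⟩, hA.iff_tendsto_slope_semigroup⟩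

theorem variationOfConstants_iff {t : ℝ} :
    VariationOfConstants (semigroup A) F g u₀ u t ↔
      u t = mildSolution A u₀ (fun s => g - F (u s)) t := by
  rw [VariationOfConstants, mildSolution, sub_eq_add_neg, ← intervalIntegral.integral_neg]
  simp only [← map_neg, neg_sub]

theorem isSolutionOn_iff_isWeakSolutionOn (hu : ContinuousOn u (Icc 0 T)) :
    IsSolutionOn A F g u₀ T u ↔
      u 0 = u₀ ∧ IsWeakSolutionOn A u₀ (fun s => g - F (u s)) T u := by
  have hintegrand : ∀ φ ψ : H, (fun s => -inner ℝ (u s) ψ + inner ℝ (g - F (u s)) φ) =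
      fun s => -inner ℝ (u s) ψ - inner ℝ (F (u s)) φ + inner ℝ g φ := fun φ ψ => by
    ext s
    rw [inner_sub_left]
    ring
  simp only [IsWeakSolutionOn, hintegrand]
  exact ⟨fun h => ⟨h.initial, h.equation⟩, fun h => ⟨hu, h.1, h.2⟩⟩

theorem isSolutionOn_iff_variationOfConstants (hA : IsNonnegSelfAdjoint A) (hF : Continuous F)
    (hT : 0 ≤ T) (hu : ContinuousOn u (Icc 0 T)) :
    IsSolutionOn A F g u₀ T u ↔
      ∀ t ∈ Icc 0 T, VariationOfConstants (semigroup A) F g u₀ u t := by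
  rw [isSolutionOn_iff_isWeakSolutionOn hu, hA.isWeakSolutionOn_iff hT hu (by fun_prop)]
  simp only [variationOfConstants_iff]
  refine ⟨fun h => h.2, fun h => ⟨?_, h⟩⟩
  rw [h 0 (left_mem_Icc.2 hT), mildSolution, hA.semigroup_zero, intervalIntegral.integral_same,
    add_zero]
  rfl

theorem IsMAccretive.continuous_semigroup_sub_kernel (hA : IsMAccretive A) (hF : Continuous F)
    (g : H) : Continuous fun p : ℝ × ℝ × H => semigroup A (p.1 - p.2.1) (g - F p.2.2) :=
  (continuous_uncurry_of_norm_le hA.norm_semigroup_le_one hA.continuous_semigroup_apply).comp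
    (f := fun p : ℝ × ℝ × H => (p.1 - p.2.1, g - F p.2.2)) (by fun_prop)

theorem IsMAccretive.lipschitzWith_semigroup_sub (hA : IsMAccretive A) (hF : LipschitzWith L F)
    (g : H) (t : ℝ) : LipschitzWith L fun y => semigroup A t (g - F y) := by
  refine LipschitzWith.of_dist_le_mul fun y z => ?_
  rw [dist_eq_norm, dist_eq_norm, ← map_sub, sub_sub_sub_cancel_left, norm_sub_rev y z]
  exact (hA.norm_semigroup_apply_le t _).trans (hF.norm_sub_le z y)

theorem isVolterraSolutionOn_iff_variationOfConstants (hu : ContinuousOn u (Icc 0 T)) :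
    IsVolterraSolutionOn (fun t s y => semigroup A (t - s) (g - F y))
        (fun t => semigroup A t u₀) T u ↔
      ∀ t ∈ Icc 0 T, VariationOfConstants (semigroup A) F g u₀ u t := by
  simp only [variationOfConstants_iff]
  exact ⟨fun h => h.eq, fun h => ⟨hu, h⟩⟩

theorem IsMAccretive.eqOn_of_variationOfConstants (hA : IsMAccretive A) (hF : LipschitzWith L F)
    (hu : ContinuousOn u (Icc 0 T)) (hv : ContinuousOn v (Icc 0 T))
    (hvoc_u : ∀ t ∈ Icc 0 T, VariationOfConstants (semigroup A) F g u₀ u t)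
    (hvoc_v : ∀ t ∈ Icc 0 T, VariationOfConstants (semigroup A) F g u₀ v t) :
    EqOn u v (Icc 0 T) :=
  IsVolterraSolutionOn.eqOn (hA.continuous_semigroup_sub_kernel hF.continuous g)
    (fun t s => hA.lipschitzWith_semigroup_sub hF g (t - s)) (hA.continuous_semigroup_apply u₀)
    ((isVolterraSolutionOn_iff_variationOfConstants hu).2 hvoc_u)
    ((isVolterraSolutionOn_iff_variationOfConstants hv).2 hvoc_v)

theorem IsMAccretive.exists_variationOfConstants (hA : IsMAccretive A) (hF : LipschitzWith L F)
    (g u₀ : H) :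
    ∃ u, ContinuousOn u (Ici 0) ∧ ∀ t, 0 ≤ t → VariationOfConstants (semigroup A) F g u₀ u t := by
  obtain ⟨u, hu⟩ := exists_forall_isVolterraSolutionOn
    (hA.continuous_semigroup_sub_kernel hF.continuous g)
    (fun t s => hA.lipschitzWith_semigroup_sub hF g (t - s)) (hA.continuous_semigroup_apply u₀)
  refine ⟨u, fun t ht => ?_, fun t ht =>
    (isVolterraSolutionOn_iff_variationOfConstants (hu t).continuousOn).1 (hu t) t ⟨ht, le_rfl⟩⟩
  have hmem : Icc 0 (t + 1) ∈ 𝓝[Ici 0] t :=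
    mem_nhdsWithin.2 ⟨Iio (t + 1), isOpen_Iio, lt_add_one t, fun _ hs => ⟨hs.2, le_of_lt hs.1⟩⟩
  exact ((hu (t + 1)).continuousOn t ⟨ht, (lt_add_one t).le⟩).mono_of_mem_nhdsWithin hmem

end Semilinear

end AnomalousDiffusion

theorem theorem3p1_general (α ε : ℝ) (hα₀ : 0 < α) (hα₂ : α < 2) (hε : 0 < ε)
    (f : ℝ → ℝ)
    (hfH : ∀ u : AnomalousDiffusion.H,
      MemLp (fun x => f (u x)) 2 AnomalousDiffusion.μΩ)
    (hfLip : LocallyLipschitz (AnomalousDiffusion.nemytskii f hfH))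
    (g : AnomalousDiffusion.H) :
    ∃ S : ℝ → AnomalousDiffusion.H →L[ℝ] AnomalousDiffusion.H,
      AnomalousDiffusion.IsExpNeg (AnomalousDiffusion.IsAeps ε α) S ∧
      ∀ u₀ : AnomalousDiffusion.H, ∃ u : ℝ → AnomalousDiffusion.H,
        ContinuousOn u (Ici 0) ∧
        (∀ T : ℝ, 0 < T → AnomalousDiffusion.IsSolutionOn (AnomalousDiffusion.IsAeps ε α)
          (AnomalousDiffusion.nemytskii f hfH) g u₀ T u) ∧
        (∀ t : ℝ, 0 ≤ t → AnomalousDiffusion.VariationOfConstants S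
          (AnomalousDiffusion.nemytskii f hfH) g u₀ u t) ∧
        ∀ T : ℝ, 0 < T → ∀ v : ℝ → AnomalousDiffusion.H, ContinuousOn v (Icc 0 T) →
          (AnomalousDiffusion.IsSolutionOn (AnomalousDiffusion.IsAeps ε α)
              (AnomalousDiffusion.nemytskii f hfH) g u₀ T v ∨
            ∀ t ∈ Icc 0 T, AnomalousDiffusion.VariationOfConstants S
              (AnomalousDiffusion.nemytskii f hfH) g u₀ v t) →
          EqOn v u (Icc 0 T) := by
  have hA := AnomalousDiffusion.isNonnegSelfAdjoint_isAeps hε hα₀ hα₂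
  obtain ⟨L, s, hs, hL⟩ := hfLip 0
  have hF := AnomalousDiffusion.lipschitzWith_nemytskii hfH
    (AnomalousDiffusion.lipschitzWith_of_lipschitzOnWith_nemytskii hs hL)
  refine ⟨AnomalousDiffusion.semigroup (AnomalousDiffusion.IsAeps ε α), hA.isExpNeg, fun u₀ => ?_⟩
  obtain ⟨u, hu, hvoc⟩ := hA.exists_variationOfConstants hF g u₀
  have hu_Icc (T : ℝ) : ContinuousOn u (Icc 0 T) := hu.mono Icc_subset_Ici_self
  have hsol {T : ℝ} (hT : 0 < T) {v} (hv : ContinuousOn v (Icc 0 T)) :=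
    AnomalousDiffusion.isSolutionOn_iff_variationOfConstants (g := g) (u₀ := u₀) hA hF.continuous
      hT.le hv
  refine ⟨u, hu, fun T hT => (hsol hT (hu_Icc T)).2 fun t ht => hvoc t ht.1, hvoc,
    fun T hT v hv h => ?_⟩
  exact hA.eqOn_of_variationOfConstants hF hv (hu_Icc T) (h.elim (hsol hT hv).1 id)
    fun t ht => hvoc t ht.1

theorem theorem3p1 (α ε : ℝ) (hα₀ : 0 < α) (hα₂ : α < 2) (hε : 0 < ε)
    (f : ℝ → ℝ)
    (hfH : ∀ u : AnomalousDiffusion.H,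
      MemLp (fun x => f (u x)) 2 AnomalousDiffusion.μΩ)
    (hfLip : LocallyLipschitz (AnomalousDiffusion.nemytskii f hfH))
    (p : ℝ) (hp : 2 ≤ p) (hf : AnomalousDiffusion.GrowthCondition f p)
    (g : AnomalousDiffusion.H) :
    ∃ S : ℝ → AnomalousDiffusion.H →L[ℝ] AnomalousDiffusion.H,
      AnomalousDiffusion.IsExpNeg (AnomalousDiffusion.IsAeps ε α) S ∧
      ∀ u₀ : AnomalousDiffusion.H, ∃ u : ℝ → AnomalousDiffusion.H,
        ContinuousOn u (Ici 0) ∧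
        (∀ T : ℝ, 0 < T → AnomalousDiffusion.IsSolutionOn (AnomalousDiffusion.IsAeps ε α)
          (AnomalousDiffusion.nemytskii f hfH) g u₀ T u) ∧
        (∀ t : ℝ, 0 ≤ t → AnomalousDiffusion.VariationOfConstants S
          (AnomalousDiffusion.nemytskii f hfH) g u₀ u t) ∧
        ∀ T : ℝ, 0 < T → ∀ v : ℝ → AnomalousDiffusion.H, ContinuousOn v (Icc 0 T) →
          (AnomalousDiffusion.IsSolutionOn (AnomalousDiffusion.IsAeps ε α)
              (AnomalousDiffusion.nemytskii f hfH) g u₀ T v ∨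
            ∀ t ∈ Icc 0 T, AnomalousDiffusion.VariationOfConstants S
              (AnomalousDiffusion.nemytskii f hfH) g u₀ v t) →
          EqOn v u (Icc 0 T) :=
  theorem3p1_general α ε hα₀ hα₂ hε f hfH hfLip g
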